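/- Let $F_n$ be the free group with basis $A=\{a_1,\dots,a_n\}$, $n\ge 0$, whose elements are identified with the reduced words over $A^{\pm}=A\sqcup A^{-1}$, and let $H\le F_n$ be a finitely generated subgroup. An element $u\in F_n$ is a $\cap$-cocycle of $H$ if $H\cap\langle u\rangle=\{1\}$, and it is cyclically reduced if its reduced word does not have mutually inverse first and last letters (the empty word is cyclically reduced). The set of cyclically reduced $\cap$-cocycles of $H$ is a rational subset of $F_n$: it is obtained from finite subsets of $F_n$ by finitely many unions, products and stars (generated submonoids), and the reduced words representing its elements form a rational language over $A^{\pm}$. Moreover, a finite automaton recognizing this language is effectively computable: there is an algorithm that, given $n$ and a finite list of words over $A^{\pm}$ generating $H$, outputs a finite automaton whose language is the set of reduced words of the cyclically reduced $\cap$-cocycles of $H$. Furthermore, let the Stallings automaton of $H$ be the core of its right Schreier automaton: its vertices are the right cosets $Hg$ that appear in some closed walk at the basepoint $H$ with reduced label, and its arcs are all the arcs $Hg\xrightarrow{a}Hga$ ($a\in A^{\pm}$) between such vertices. It has finitely many vertices and, if $m$ is their number, then every nontrivial cyclically reduced $u\in F_n$ satisfies $\langle u\rangle\cap H=\{1\}$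 if and only if $u^m$ does not label any walk starting at the basepoint of the Stallings automaton. -/

import Mathlib

/-- Rational subsets of a monoid: the smallest family of subsets that contains the finite ones
and is closed under union, product and star (the submonoid generated by a subset). -/
inductive IsRationalSubset {M : Type*} [Monoid M] : Set M → Prop
  | empty : IsRationalSubset ∅
  | singleton (x : M) : IsRationalSubset {x}
  | union {S T : Set M} : IsRationalSubset S → IsRationalSubset T → IsRationalSubset (S ∪ T)
  | mul {S T : Set M} : IsRationalSubset S → IsRationalSubset T →
      IsRationalSubset (Set.image2 (fun x y => x * y) S T)
  | star {S : Set M} : IsRationalSubset S →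
      IsRationalSubset (Submonoid.closure S : Set M)

/-- Rational languages: those obtained from the empty language, the empty word and the letters
by finitely many unions, products and stars. -/
def IsRationalLanguage {α : Type*} (L : Language α) : Prop :=
  ∃ R : RegularExpression α, R.matches' = L

/-- `K` is a `∩`-complement of `H`. -/
def IsMeetComplement {G : Type*} [Group G] (H K : Subgroup G) : Prop :=
  H ⊓ K = ⊥

/-- `u` is (a generator of) a `∩`-cocycle, that is, of a cyclic `∩`-complement, of `H`. -/
def IsMeetCocycle {G : Type*} [Group G] (H : Subgroup G) (u : G) : Prop :=
  IsMeetComplement H (Subgroup.zpowers u)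

/-- The cyclically reduced `∩`-cocycles of a subgroup of a free group. -/
def crMeetCocycles {α : Type*} [DecidableEq α] (H : Subgroup (FreeGroup α)) :
    Set (FreeGroup α) :=
  {u | FreeGroup.IsCyclicallyReduced u.toWord ∧ IsMeetCocycle H u}

/-- The reduced words that represent the elements of a subset of a free group. The letter
`(a, true)` stands for `a` and the letter `(a, false)` for its inverse. -/
def reducedWords {α : Type*} [DecidableEq α] (S : Set (FreeGroup α)) : Language (α × Bool) :=
  {w | ∃ u ∈ S, FreeGroup.toWord u = w}

/-- The right Schreier automaton of `H`: its vertices are the right cosets `H g`, with an arc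
labelled `a` from `H g` to `H g a` for every letter `a`, and `H` as the basepoint (the unique
initial and unique final state). -/
def schreierAutomaton {α : Type*} (H : Subgroup (FreeGroup α)) :
    NFA (α × Bool) (Quotient (QuotientGroup.rightRel H)) where
  step v a := {w | ∃ g : FreeGroup α, v = Quotient.mk _ g ∧ w = Quotient.mk _ (g * FreeGroup.mk [a])}
  start := {Quotient.mk _ 1}
  accept := {Quotient.mk _ 1}

/-- The vertices that appear in some walk with reduced label from an initial to a final state. -/
def coreVertices {α σ : Type*} (M : NFA (α × Bool) σ) : Set σ :=
  {v | ∃ w₁ w₂ : List (α × Bool), FreeGroup.IsReduced (w₁ ++ w₂) ∧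
    v ∈ M.evalFrom M.start w₁ ∧ ∃ b ∈ M.accept, b ∈ M.evalFrom {v} w₂}

/-- The restriction of an automaton to its core vertices. -/
def coreAutomaton {α σ : Type*} (M : NFA (α × Bool) σ) : NFA (α × Bool) (coreVertices M) where
  step v a := {w | (w : σ) ∈ M.step v a}
  start := {v | (v : σ) ∈ M.start}
  accept := {v | (v : σ) ∈ M.accept}

/-- The vertices of the Stallings automaton. -/
abbrev StallingsVertex {α : Type*} (H : Subgroup (FreeGroup α)) : Type _ :=
  coreVertices (schreierAutomaton H)

/-- The Stallings automaton of `H`: the core of its right Schreier automaton. -/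
def stallingsAutomaton {α : Type*} (H : Subgroup (FreeGroup α)) :
    NFA (α × Bool) (StallingsVertex H) :=
  coreAutomaton (schreierAutomaton H)

/-- The word `w` labels some walk that starts at an initial state of `M`. -/
def IsReadable {α σ : Type*} (M : NFA α σ) (w : List α) : Prop :=
  (M.evalFrom M.start w).Nonempty

/-- Explicit descriptions of finite automata over letters `(i, b)`, `i` a natural number:
the number `N` of states (which are `0, …, N - 1`), the list of initial states, the list of final
states, and the list of arcs `(p, a, q)` from `p` to `q` with label `a`. -/
abbrev AutomatonCode : Type :=
  ℕ × List ℕ × List ℕ × List (ℕ × (ℕ × Bool) × ℕ)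

/-- The finite automaton over the letters of the free group of rank `n` with a given
description. -/
def AutomatonCode.toNFA (c : AutomatonCode) (n : ℕ) : NFA (Fin n × Bool) (Fin c.1) where
  step p a := {q | ((p : ℕ), ((a.1 : ℕ), a.2), (q : ℕ)) ∈ c.2.2.2}
  start := {p | (p : ℕ) ∈ c.2.1}
  accept := {p | (p : ℕ) ∈ c.2.2.1}

/-- A finite list of words over the letters of the free group of rank `n`, written as data that
do not depend on `n`. -/
def encodeWords {n : ℕ} (gens : List (List (Fin n × Bool))) : List (List (ℕ × Bool)) :=
  gens.map fun w => w.map fun a => ((a.1 : ℕ), a.2)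

/-- The subgroup of the free group generated by a finite list of words. -/
def subgroupOfWords {n : ℕ} (gens : List (List (Fin n × Bool))) : Subgroup (FreeGroup (Fin n)) :=
  Subgroup.closure {g | ∃ w ∈ gens, FreeGroup.mk w = g}

/-! Let `V` be a finite prefix-closed set of words containing generators of `H`. A walk in the
Schreier graph with reduced label between cosets represented in `V` visits only such cosets
(`IsHull.exists_leads`): some unreduced label of the same group element has a walk inside the hull,
and free reduction only deletes vertices. If `u` is cyclically reduced, all its powers are reduced
words. Thus `u ^ k ∈ H` with `k > 0` puts every coset `H u ^ i` in the hull, and by pigeonhole some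
exponent at most `V.length` already works (`IsHull.isCocycleWord_iff`). The same argument on the
vertices of the core gives the criterion with `u ^ m` (`isMeetCocycle_iff_not_isReadable`).

For rationality, each reduced word induces a relation on `V`, and relations compose along reduced
concatenations (`IsHull.leads_append_iff`). That relation, together with the first and last letters,
decides whether a reduced word is a cocycle word, and is compatible with appending a letter. Over a
finite alphabet there are finitely many classes; they are the states of an automaton, and Kleene's
theorem turns it into a regular expression, whose image in the free group is a rational subset.

For effectiveness, the automaton is found by unbounded search for a certificate: a code, one word
per state, and a hull (`Certifies`). Certificates exist by the finiteness above, and checking one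
needs finitely many membership tests. Membership in a finitely generated subgroup is decidable
because it and its negation are both recursively enumerable: products of generators witness the
first, finite permutation actions the second (Marshall Hall). -/

open scoped Computability

/-! ### Rational languages: closure properties and images in free groups. -/

namespace IsRationalLanguage

variable {α : Type*} {L L' : Language α}

theorem zero : IsRationalLanguage (0 : Language α) := ⟨0, rfl⟩

theorem one : IsRationalLanguage (1 : Language α) := ⟨1, rfl⟩

theorem char (a : α) : IsRationalLanguage ({[a]} : Language α) := ⟨.char a, rfl⟩

theorem add (h : IsRationalLanguage L) (h' : IsRationalLanguage L') :
    IsRationalLanguage (L + L') := by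
  obtain ⟨R, rfl⟩ := h
  obtain ⟨R', rfl⟩ := h'
  exact ⟨R + R', rfl⟩

theorem mul (h : IsRationalLanguage L) (h' : IsRationalLanguage L') :
    IsRationalLanguage (L * L') := by
  obtain ⟨R, rfl⟩ := h
  obtain ⟨R', rfl⟩ := h'
  exact ⟨R * R', rfl⟩

theorem kstar (h : IsRationalLanguage L) : IsRationalLanguage (L∗) := by
  obtain ⟨R, rfl⟩ := h
  exact ⟨R.star, rfl⟩

theorem congr (h : IsRationalLanguage L) (H : ∀ w, w ∈ L' ↔ w ∈ L) : IsRationalLanguage L' := by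
  rwa [show L' = L from Set.ext H]

theorem biUnion {ι : Type*} {s : Set ι} (hs : s.Finite) {f : ι → Language α}
    (hf : ∀ i ∈ s, IsRationalLanguage (f i)) :
    IsRationalLanguage ({w | ∃ i ∈ s, w ∈ f i} : Language α) := by
  induction s, hs using Set.Finite.induction_on with
  | empty =>
    refine zero.congr fun w => ?_
    change (∃ i ∈ (∅ : Set ι), w ∈ f i) ↔ False
    simp
  | @insert i s _ _ ih =>
    refine (add (hf i (Set.mem_insert _ _))
      (ih fun j hj => hf j (Set.mem_insert_of_mem _ hj))).congr fun w => ?_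
    change (∃ j ∈ insert i s, w ∈ f j) ↔ w ∈ f i ∨ ∃ j ∈ s, w ∈ f j
    simp

/-- The image in a free group of a rational language is a rational subset. -/
theorem isRationalSubset_image {α : Type*} {L : Language (α × Bool)} (h : IsRationalLanguage L) :
    IsRationalSubset ((FreeGroup.mk : List (α × Bool) → FreeGroup α) '' (L : Set _)) := by
  obtain ⟨R, rfl⟩ := h
  -- `FreeGroup.mk` turns concatenation into multiplication, so it carries each regular operation to
  -- the corresponding operation on subsets.
  induction R with
  | zero =>
    convert! IsRationalSubset.empty
    exact Set.image_empty _
  | epsilon =>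
    convert! IsRationalSubset.singleton (1 : FreeGroup α)
    exact Set.image_singleton
  | char a =>
    convert! IsRationalSubset.singleton (FreeGroup.mk [a])
    exact Set.image_singleton
  | plus P Q hP hQ =>
    convert! hP.union hQ
    exact Set.image_union _ _ _
  | comp P Q hP hQ =>
    convert! hP.mul hQ
    exact Set.image_image2_distrib fun _ _ => FreeGroup.mul_mk.symm
  | star P hP =>
    convert! hP.star
    ext g
    simp only [SetLike.mem_coe]
    constructor
    · rintro ⟨w, hw, rfl⟩
      obtain ⟨ws, rfl, hws⟩ := hw
      clear hP
      induction ws with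
      | nil => exact one_mem _
      | cons u ws ih =>
        rw [List.flatten_cons, ← FreeGroup.mul_mk]
        exact mul_mem (Submonoid.subset_closure ⟨u, hws u (by simp), rfl⟩)
          (ih fun y hy => hws y (by simp [hy]))
    · intro hg
      induction hg using Submonoid.closure_induction with
      | mem x hx =>
        obtain ⟨w, hw, rfl⟩ := hx
        exact ⟨w, le_kstar (a := P.matches') hw, rfl⟩
      | one => exact ⟨[], Language.nil_mem_kstar _, rfl⟩
      | mul x y _ _ hx hy =>
        obtain ⟨u, hu, rfl⟩ := hx
        obtain ⟨v, hv, rfl⟩ := hy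
        refine ⟨u ++ v, ?_, FreeGroup.mul_mk.symm⟩
        have : u ++ v ∈ P.matches'∗ * P.matches'∗ := Language.append_mem_mul hu hv
        rwa [kstar_mul_kstar] at this

end IsRationalLanguage

/-! ### Kleene's theorem: from finite automata to regular expressions. -/

namespace NFA

variable {α σ : Type*} (M : NFA α σ)

/-- `M.Via S p w q`: the word `w` labels a walk from `p` to `q` with all its inner states
in `S`. -/
inductive Via (S : Set σ) : σ → List α → σ → Prop
  | nil (p : σ) : Via S p [] p
  | single {p q : σ} {a : α} (h : q ∈ M.step p a) : Via S p [a] q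
  | trans {p r q : σ} {u v : List α} (hr : r ∈ S) (hu : Via S p u r) (hv : Via S r v q) :
      Via S p (u ++ v) q

/-- The labels of the walks from `p` to `q` with all inner states in `S`. -/
def viaLanguage (S : Set σ) (p q : σ) : Language α := {w | M.Via S p w q}

variable {M}

theorem Via.mono {S T : Set σ} (h : S ⊆ T) {p q : σ} {w : List α} (hw : M.Via S p w q) :
    M.Via T p w q := by
  induction hw with
  | nil p => exact .nil p
  | single h => exact .single h
  | trans hr _ _ hu hv => exact .trans (h hr) hu hv

theorem viaLanguage_mul_le {S : Set σ} {p r q : σ} (hr : r ∈ S) :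
    M.viaLanguage S p r * M.viaLanguage S r q ≤ M.viaLanguage S p q := by
  intro w hw
  obtain ⟨u, hu, v, hv, rfl⟩ := Language.mem_mul.1 hw
  exact .trans hr hu hv

theorem viaLanguage_mono {S T : Set σ} (h : S ⊆ T) (p q : σ) :
    M.viaLanguage S p q ≤ M.viaLanguage T p q :=
  fun _ hw => Via.mono h hw

/-- Kleene's recursion: cut a walk at its visits to `s`. -/
theorem viaLanguage_insert (s : σ) (S : Set σ) (p q : σ) :
    M.viaLanguage (insert s S) p q = M.viaLanguage S p q +
      M.viaLanguage S p s * (M.viaLanguage S s s)∗ * M.viaLanguage S s q := by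
  apply le_antisymm
  · intro w hw
    change M.Via _ _ _ _ at hw
    induction hw with
    | nil p => exact Or.inl (.nil p)
    | single h => exact Or.inl (.single h)
    | @trans p r q u v hr _ _ ihu ihv =>
      have huv := Language.append_mem_mul ihu ihv
      revert huv
      generalize u ++ v = w
      -- Walks are built by concatenation at an inner state `r`, so it remains to absorb a product
      -- of two right-hand sides; this is pure Kleene algebra.
      suffices h : (M.viaLanguage S p r +
          M.viaLanguage S p s * (M.viaLanguage S s s)∗ * M.viaLanguage S s r) *
          (M.viaLanguage S r q +
          M.viaLanguage S r s * (M.viaLanguage S s s)∗ * M.viaLanguage S s q) ≤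
          M.viaLanguage S p q +
          M.viaLanguage S p s * (M.viaLanguage S s s)∗ * M.viaLanguage S s q from fun hw => h hw
      set C := (M.viaLanguage S s s)∗
      have hCC : C * C = C := kstar_mul_kstar _
      have hsC : M.viaLanguage S s s ≤ C := le_kstar
      have h1C : 1 ≤ C := one_le_kstar
      rw [add_mul, mul_add, mul_add]
      rcases hr with rfl | hr
      -- The junction is the new state: all four products pass through it, and adjacent loop factors
      -- merge by `C * C = C`.
      · refine add_le (add_le ?_ ?_) (add_le ?_ ?_) <;> refine le_trans ?_ le_add_self
        · calc _ = M.viaLanguage S p r * 1 * M.viaLanguage S r q := by rw [mul_one]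
            _ ≤ _ := by gcongr
        · calc _ ≤ M.viaLanguage S p r * (C * C * M.viaLanguage S r q) := by gcongr
            _ = _ := by rw [hCC, mul_assoc]
        · calc _ ≤ M.viaLanguage S p r * C * C * M.viaLanguage S r q := by gcongr
            _ = _ := by rw [mul_assoc _ C C, hCC]
        · calc _ ≤ M.viaLanguage S p r * C * C * (C * C * M.viaLanguage S r q) := by gcongr
            _ = M.viaLanguage S p r * (C * C * (C * C)) * M.viaLanguage S r q := by
              simp only [mul_assoc]
            _ = _ := by rw [hCC, hCC]
      -- The junction lies in `S`: the two factors meeting at `r` fuse into one `S`-walk, which is a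
      -- loop at `s`, hence in `C`, in the last case.
      · refine add_le (add_le ?_ ?_) (add_le ?_ ?_)
        · exact (viaLanguage_mul_le hr).trans le_self_add
        · refine le_trans ?_ le_add_self
          rw [← mul_assoc, ← mul_assoc]
          gcongr
          exact viaLanguage_mul_le hr
        · refine le_trans ?_ le_add_self
          rw [mul_assoc _ _ (M.viaLanguage S r q)]
          gcongr
          exact viaLanguage_mul_le hr
        · refine le_trans ?_ le_add_self
          calc _ = M.viaLanguage S p s * (C * (M.viaLanguage S s r * M.viaLanguage S r s) * C) *
                M.viaLanguage S s q := by simp only [mul_assoc]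
            _ ≤ M.viaLanguage S p s * (C * C * C) * M.viaLanguage S s q := by
              gcongr
              exact (viaLanguage_mul_le hr).trans hsC
            _ = _ := by rw [hCC, hCC]
  · have hs : s ∈ insert s S := Set.mem_insert _ _
    have hm := fun p q => viaLanguage_mono (M := M) (Set.subset_insert s S) p q
    refine add_le (hm p q) ?_
    calc _ ≤ M.viaLanguage (insert s S) p s * (M.viaLanguage (insert s S) s s)∗ *
          M.viaLanguage (insert s S) s q := by
          have := kstar_mono (hm s s)
          have := hm p s
          have := hm s q
          gcongr
      _ ≤ M.viaLanguage (insert s S) p s * M.viaLanguage (insert s S) s q := by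
          gcongr
          exact mul_kstar_le_self (viaLanguage_mul_le hs)
      _ ≤ _ := viaLanguage_mul_le hs

theorem isRationalLanguage_viaLanguage [Finite α] {S : Set σ} (hS : S.Finite) (p q : σ) :
    IsRationalLanguage (M.viaLanguage S p q) := by
  induction S, hS using Set.Finite.induction_on generalizing p q with
  | empty =>
    -- The union over `Unit` contributes the empty word exactly when `p = q`, without a case split.
    have h := (IsRationalLanguage.biUnion (Set.toFinite {_u : Unit | p = q})
      fun _ _ => IsRationalLanguage.one (α := α)).add
      (IsRationalLanguage.biUnion (Set.toFinite {a : α | q ∈ M.step p a})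
      fun a _ => IsRationalLanguage.char a)
    refine h.congr fun w => ?_
    change M.Via ∅ p w q ↔ (∃ _u : Unit, p = q ∧ w = []) ∨
      ∃ a, q ∈ M.step p a ∧ w = [a]
    constructor
    · intro h
      cases h with
      | nil => exact .inl ⟨(), rfl, rfl⟩
      | single h => exact .inr ⟨_, h, rfl⟩
      | trans hr => exact hr.elim
    · rintro (⟨_, rfl, rfl⟩ | ⟨a, h, rfl⟩)
      · exact .nil _
      · exact .single h
  | @insert s S _ _ ih =>
    rw [viaLanguage_insert]
    exact (ih p q).add (((ih p s).mul (ih s s).kstar).mul (ih s q))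

theorem via_univ_iff {p q : σ} {w : List α} : M.Via Set.univ p w q ↔ q ∈ M.evalFrom {p} w := by
  constructor
  · intro h
    induction h with
    | nil p => simp
    | single h => simpa using h
    | trans _ _ _ hu hv =>
      rw [evalFrom_append, mem_evalFrom_iff_exists]
      exact ⟨_, hu, hv⟩
  · intro h
    induction w generalizing p with
    | nil =>
      obtain rfl : q = p := by simpa using h
      exact .nil _
    | cons a w ih =>
      rw [evalFrom_cons, stepSet_singleton, mem_evalFrom_iff_exists] at h
      obtain ⟨r, hr, hq⟩ := h
      exact .trans (Set.mem_univ r) (.single hr) (ih hq)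

/-- Half of Kleene's theorem. -/
theorem isRationalLanguage_accepts [Finite α] [Finite σ] (M : NFA α σ) :
    IsRationalLanguage M.accepts := by
  have h := IsRationalLanguage.biUnion (Set.toFinite M.start) fun p _ =>
    IsRationalLanguage.biUnion (Set.toFinite M.accept) fun q _ =>
    isRationalLanguage_viaLanguage (M := M) Set.finite_univ p q
  refine h.congr fun w => ?_
  change (∃ q ∈ M.accept, q ∈ M.evalFrom M.start w) ↔ ∃ p ∈ M.start, ∃ q ∈ M.accept,
    M.Via Set.univ p w q
  simp only [via_univ_iff, mem_evalFrom_iff_exists (S := M.start)]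
  tauto

end NFA

/-! ### Walks in the Cayley graph and free reduction. -/

/-- The walk with label `w` from `g` in the Cayley graph stays in `X`. -/
def WalkIn {α : Type*} (X : Set (FreeGroup α)) (g : FreeGroup α) (w : List (α × Bool)) : Prop :=
  ∀ u v, w = u ++ v → g * FreeGroup.mk u ∈ X

namespace WalkIn

open FreeGroup

variable {α : Type*} {X : Set (FreeGroup α)} {g : FreeGroup α} {w w' : List (α × Bool)}

theorem append (h : WalkIn X g w) (h' : WalkIn X (g * mk w) w') : WalkIn X g (w ++ w') := by
  intro u v huv
  rcases List.append_eq_append_iff.1 huv with ⟨c, rfl, rfl⟩ | ⟨c, rfl, rfl⟩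
  · rw [← mul_mk, ← mul_assoc]
    exact h' c v rfl
  · exact h u c rfl

theorem invRev (h : WalkIn X g w) : WalkIn X (g * mk w) (FreeGroup.invRev w) := by
  intro u v huv
  have hw : w = FreeGroup.invRev v ++ FreeGroup.invRev u := by
    rw [← invRev_append, ← huv, invRev_invRev]
  have := h _ _ hw
  rwa [hw, ← mul_mk, mul_assoc, mul_assoc, mul_mk (L₁ := FreeGroup.invRev u), ← mul_mk,
    ← inv_mk (L := u), inv_mul_cancel, mul_one]

/-- Cancelling an inverse pair removes a back-and-forth detour, so the shorter walk visits no new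
vertex. -/
theorem step (h : WalkIn X g w) (hs : Red.Step w w') : WalkIn X g w' := by
  cases hs with
  | @not L₁ L₂ x b =>
    intro u v huv
    rcases List.append_eq_append_iff.1 huv with ⟨c, rfl, rfl⟩ | ⟨c, rfl, rfl⟩
    · have := h (L₁ ++ (x, b) :: (x, !b) :: c) v (by simp)
      rwa [show mk (L₁ ++ (x, b) :: (x, !b) :: c) = mk (L₁ ++ c) from Quot.sound .not] at this
    · exact h u (c ++ (x, b) :: (x, !b) :: L₂) (by simp)

theorem red (h : WalkIn X g w) (hs : Red w w') : WalkIn X g w' := by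
  induction hs with
  | refl => exact h
  | tail _ hs ih => exact ih.step hs

end WalkIn

/-! ### Hulls, and the action of reduced words on them. -/

/-- `V` is a set of words, closed under prefixes, that contains a set of generators of `H`. The
right cosets of its elements span a connected subgraph of the Schreier graph of `H` that contains
the core. -/
structure IsHull {α : Type*} (H : Subgroup (FreeGroup α)) (V : Set (List (α × Bool))) : Prop where
  nil_mem : [] ∈ V
  dropLast_mem : ∀ v ∈ V, v.dropLast ∈ V
  exists_generators : ∃ G ⊆ V, H = Subgroup.closure (FreeGroup.mk '' G)

/-- `w` leads from the right coset of `p` to the right coset of `q`. -/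
def Leads {α : Type*} (H : Subgroup (FreeGroup α)) (w p q : List (α × Bool)) : Prop :=
  FreeGroup.mk (p ++ w ++ FreeGroup.invRev q) ∈ H

/-- The words `u` and `w` have the same first letter, the same last letter and the same
action on `V`. -/
structure SameAction {α : Type*} (H : Subgroup (FreeGroup α)) (V : Set (List (α × Bool)))
    (u w : List (α × Bool)) : Prop where
  head : u.head? = w.head?
  last : u.getLast? = w.getLast?
  leads : ∀ p ∈ V, ∀ q ∈ V, (Leads H u p q ↔ Leads H w p q)

section Hull

open FreeGroup

variable {α : Type*} {H : Subgroup (FreeGroup α)} {V : Set (List (α × Bool))}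
  {u w p q r : List (α × Bool)}

theorem leads_iff : Leads H w p q ↔ FreeGroup.mk p * FreeGroup.mk w * (FreeGroup.mk q)⁻¹ ∈ H := by
  rw [Leads, ← mul_mk, ← mul_mk, inv_mk]

theorem leads_nil_nil : Leads H w [] [] ↔ FreeGroup.mk w ∈ H := by
  simp [Leads, FreeGroup.invRev]

theorem Leads.append (h : Leads H u p r) (h' : Leads H w r q) : Leads H (u ++ w) p q := by
  rw [leads_iff] at *
  convert! mul_mem h h' using 1
  rw [← mul_mk]
  group

theorem Leads.of_append (h : Leads H (u ++ w) p q) (h' : Leads H u p r) : Leads H w r q := by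
  rw [leads_iff] at *
  convert! mul_mem (inv_mem h') h using 1
  rw [← mul_mk]
  group

namespace IsHull

theorem walkIn_of_mem (hV : IsHull H V) {v : List (α × Bool)} (hv : v ∈ V) :
    WalkIn {g | ∃ r ∈ V, g * (FreeGroup.mk r)⁻¹ ∈ H} 1 v := by
  intro u t hut
  induction t using List.reverseRecOn generalizing v with
  | nil =>
    rw [List.append_nil] at hut
    subst hut
    exact ⟨_, hv, by rw [one_mul, mul_inv_cancel]; exact one_mem H⟩
  | append_singleton t a ih =>
    apply ih (hV.dropLast_mem v hv)
    rw [hut, ← List.append_assoc, List.dropLast_concat]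

theorem walkIn_mul {h : FreeGroup α} (hh : h ∈ H) {g : FreeGroup α}
    (hw : WalkIn {g | ∃ r ∈ V, g * (FreeGroup.mk r)⁻¹ ∈ H} g w) :
    WalkIn {g | ∃ r ∈ V, g * (FreeGroup.mk r)⁻¹ ∈ H} (h * g) w := by
  intro u v huv
  obtain ⟨r, hr, hH⟩ := hw u v huv
  exact ⟨r, hr, by simpa only [mul_assoc] using mul_mem hh hH⟩

/-- A product of generators and their inverses traces closed walks through prefixes of generators;
the set of hull vertices is invariant under left multiplication by `H`, so these walks can be
chained. The word need not be reduced. -/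
theorem exists_walkIn (hV : IsHull H V) {h : FreeGroup α} (hh : h ∈ H) :
    ∃ w, FreeGroup.mk w = h ∧ WalkIn {g | ∃ r ∈ V, g * (FreeGroup.mk r)⁻¹ ∈ H} 1 w := by
  obtain ⟨G, hG, hH⟩ := hV.exists_generators
  have hh' := hh
  rw [hH] at hh'
  induction hh' using Subgroup.closure_induction with
  | mem x hx =>
    obtain ⟨w, hw, rfl⟩ := hx
    exact ⟨w, rfl, hV.walkIn_of_mem (hG hw)⟩
  | one =>
    refine ⟨[], rfl, ?_⟩
    exact hV.walkIn_of_mem hV.nil_mem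
  | mul x y hx hy ihx ihy =>
    rw [← hH] at hx hy
    obtain ⟨u, rfl, hu⟩ := ihx hx
    obtain ⟨v, rfl, hv⟩ := ihy hy
    refine ⟨u ++ v, mul_mk.symm, hu.append ?_⟩
    rw [one_mul]
    rw [← mul_one (FreeGroup.mk u)]
    exact walkIn_mul hx hv
  | inv x hx ih =>
    rw [← hH] at hx
    obtain ⟨u, rfl, hu⟩ := ih hx
    refine ⟨FreeGroup.invRev u, inv_mk.symm, ?_⟩
    have := walkIn_mul (inv_mem hx) hu.invRev
    rwa [one_mul, inv_mul_cancel] at this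

/-- A walk with reduced label between two vertices of the hull stays in the hull. -/
theorem exists_leads (hV : IsHull H V) (hp : p ∈ V) (hq : q ∈ V) (hr : FreeGroup.IsReduced (u ++ w))
    (h : Leads H (u ++ w) p q) : ∃ r ∈ V, Leads H u p r := by
  classical
  rw [leads_iff] at h
  obtain ⟨l, hl, hwl⟩ := hV.exists_walkIn h
  have hwp := hV.walkIn_of_mem hp
  have hwq := walkIn_mul h (hV.walkIn_of_mem hq)
  -- Go from `p` back to the basepoint, around by `l`, and out along `q`. This walk stays in the
  -- hull, and its label reduces to `u ++ w`.
  have hW : WalkIn {g | ∃ r ∈ V, g * (FreeGroup.mk r)⁻¹ ∈ H} (FreeGroup.mk p) (FreeGroup.invRev p ++ (l ++ q)) := by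
    refine (by simpa using hwp.invRev : WalkIn _ (FreeGroup.mk p) _).append ?_
    rw [← inv_mk, mul_inv_cancel]
    exact hwl.append (by simpa [hl] using hwq)
  have hred : Red (FreeGroup.invRev p ++ (l ++ q)) (u ++ w) := by
    have he : reduce (FreeGroup.invRev p ++ (l ++ q)) = u ++ w := by
      rw [← hr.reduce_eq]
      apply reduce.sound
      rw [← mul_mk, ← mul_mk, hl, ← inv_mk]
      group
    rw [← he]
    exact reduce.red
  obtain ⟨r, hr, hH⟩ := hW.red hred u w rfl
  exact ⟨r, hr, leads_iff.2 hH⟩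

/-- Relations on `V` compose because a reduced walk cannot leave the hull and return. Without
reducedness the intermediate coset may have no representative in `V`. -/
theorem leads_append_iff (hV : IsHull H V) (hp : p ∈ V) (hq : q ∈ V) (hr : FreeGroup.IsReduced (u ++ w)) :
    Leads H (u ++ w) p q ↔ ∃ r ∈ V, Leads H u p r ∧ Leads H w r q := by
  constructor
  · intro h
    obtain ⟨r, hrV, hur⟩ := hV.exists_leads hp hq hr h
    exact ⟨r, hrV, hur, h.of_append hur⟩
  · rintro ⟨r, _, h, h'⟩
    exact h.append h'

end IsHull

theorem isReduced_append_singleton {a : α × Bool} :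
    FreeGroup.IsReduced (u ++ [a]) ↔ FreeGroup.IsReduced u ∧ ∀ x ∈ u.getLast?, x.1 = a.1 → x.2 = a.2 := by
  simp only [FreeGroup.IsReduced, List.isChain_append]
  simp

namespace SameAction

theorem refl (H : Subgroup (FreeGroup α)) (V : Set (List (α × Bool))) (u : List (α × Bool)) :
    SameAction H V u u := ⟨rfl, rfl, fun _ _ _ _ => Iff.rfl⟩

theorem trans {v : List (α × Bool)} (h : SameAction H V u v) (h' : SameAction H V v w) :
    SameAction H V u w :=
  ⟨h.head.trans h'.head, h.last.trans h'.last,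
    fun p hp q hq => (h.leads p hp q hq).trans (h'.leads p hp q hq)⟩

theorem symm (h : SameAction H V u w) : SameAction H V w u :=
  ⟨h.head.symm, h.last.symm, fun p hp q hq => (h.leads p hp q hq).symm⟩

theorem eq_nil_iff (h : SameAction H V u w) : u = [] ↔ w = [] := by
  rw [← List.head?_eq_none_iff, h.head, List.head?_eq_none_iff]

theorem isReduced_append (h : SameAction H V u w) (hw : FreeGroup.IsReduced w) {a : α × Bool}
    (hu : FreeGroup.IsReduced (u ++ [a])) : FreeGroup.IsReduced (w ++ [a]) := by
  rw [isReduced_append_singleton] at hu ⊢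
  exact ⟨hw, h.last ▸ hu.2⟩

/-- Right-congruence property that makes the classes usable as states: the last letter controls
reducedness of the extension, and the relations compose. -/
theorem append (h : SameAction H V u w) (hV : IsHull H V) (hw : FreeGroup.IsReduced w) {a : α × Bool}
    (hu : FreeGroup.IsReduced (u ++ [a])) : SameAction H V (u ++ [a]) (w ++ [a]) where
  head := by rw [List.head?_append, List.head?_append, h.head]
  last := by simp
  leads p hp q hq := by
    rw [hV.leads_append_iff hp hq hu, hV.leads_append_iff hp hq (h.isReduced_append hw hu)]
    exact exists_congr fun r => and_congr_right fun hr => and_congr_left fun _ =>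
      h.leads p hp r hr

theorem isCyclicallyReduced (h : SameAction H V u w) (hu : IsCyclicallyReduced u)
    (hw : FreeGroup.IsReduced w) : IsCyclicallyReduced w :=
  ⟨hw, h.last ▸ h.head ▸ hu.2⟩

/-- Powers of cyclically reduced words are reduced, so the relation of a power is the iterated
composite of the relation of the word. -/
theorem leads_replicate (h : SameAction H V u w) (hV : IsHull H V) (hu : IsCyclicallyReduced u)
    (hw : IsCyclicallyReduced w) (k : ℕ) (hp : p ∈ V) (hq : q ∈ V) :
    Leads H (List.replicate k u).flatten p q ↔ Leads H (List.replicate k w).flatten p q := by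
  induction k generalizing p with
  | zero => rfl
  | succ k ih =>
    have hur := (hu.flatten_replicate (k + 1)).isReduced
    have hwr := (hw.flatten_replicate (k + 1)).isReduced
    simp only [List.replicate_succ, List.flatten_cons] at hur hwr ⊢
    rw [hV.leads_append_iff hp hq hur, hV.leads_append_iff hp hq hwr]
    exact exists_congr fun r => and_congr_right fun hr =>
      and_congr (h.leads p hp r hr) (ih hr)

end SameAction

theorem mk_flatten_replicate (u : List (α × Bool)) (k : ℕ) :
    FreeGroup.mk (List.replicate k u).flatten = FreeGroup.mk u ^ k := by
  rw [FreeGroup.pow_mk]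

theorem FreeGroup.IsReduced.mk_eq_one_iff (hu : FreeGroup.IsReduced u) : FreeGroup.mk u = 1 ↔ u = [] := by
  classical
  rw [← toWord_eq_nil_iff, toWord_mk, hu.reduce_eq]

/-- Torsion-freeness turns `u ^ k = 1` into `u = 1`, and inversion in `H` disposes of negative
exponents. -/
theorem isMeetCocycle_iff {G : Type*} [Group G] [IsMulTorsionFree G] {H : Subgroup G} {u : G} :
    IsMeetCocycle H u ↔ ∀ k : ℕ, 0 < k → u ^ k ∈ H → u = 1 := by
  rw [IsMeetCocycle, IsMeetComplement, Subgroup.eq_bot_iff_forall]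
  constructor
  · intro h k hk hu
    exact (pow_eq_one_iff_left hk.ne').1 (h _ ⟨hu, k, by simp⟩)
  · rintro h _ ⟨hx, k, rfl⟩
    simp only at hx ⊢
    rcases eq_or_ne k 0 with rfl | hk
    · simp
    · rw [h k.natAbs (Int.natAbs_pos.2 hk) ?_, one_zpow]
      rcases Int.natAbs_eq k with hk | hk <;> rw [hk] at hx
      · exact_mod_cast hx
      · have := H.inv_mem hx
        rw [zpow_neg, inv_inv] at this
        exact_mod_cast this

/-- The words that represent cyclically reduced `∩`-cocycles of `H`. -/
structure IsCocycleWord (H : Subgroup (FreeGroup α)) (u : List (α × Bool)) : Prop where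
  isCyclicallyReduced : IsCyclicallyReduced u
  isMeetCocycle : IsMeetCocycle H (FreeGroup.mk u)

theorem mem_reducedWords_iff [DecidableEq α] :
    u ∈ reducedWords (crMeetCocycles H) ↔ IsCocycleWord H u := by
  constructor
  · rintro ⟨g, ⟨hg, hc⟩, rfl⟩
    exact ⟨hg, by rwa [mk_toWord]⟩
  · rintro ⟨hu, hc⟩
    have : (FreeGroup.mk u).toWord = u := by rw [toWord_mk, hu.isReduced.reduce_eq]
    exact ⟨FreeGroup.mk u, ⟨by rwa [this], hc⟩, this⟩

theorem SameAction.isCocycleWord (h : SameAction H V u w) (hV : IsHull H V)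
    (hu : IsCocycleWord H u) (hw : FreeGroup.IsReduced w) : IsCocycleWord H w := by
  have hwc := h.isCyclicallyReduced hu.1 hw
  refine ⟨hwc, isMeetCocycle_iff.2 fun k hk hwk => ?_⟩
  rw [hw.mk_eq_one_iff, ← h.eq_nil_iff, ← hu.1.isReduced.mk_eq_one_iff]
  refine isMeetCocycle_iff.1 hu.2 k hk ?_
  rw [← mk_flatten_replicate, ← leads_nil_nil] at hwk ⊢
  exact (h.leads_replicate hV hu.1 hwc k hV.nil_mem hV.nil_mem).2 hwk

theorem flatten_replicate_prefix (u : List (α × Bool)) {i j : ℕ} (h : i ≤ j) :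
    (List.replicate i u).flatten <+: (List.replicate j u).flatten := by
  obtain ⟨k, rfl⟩ := Nat.exists_eq_add_of_le h
  exact ⟨(List.replicate k u).flatten, by rw [List.replicate_add, List.flatten_append]⟩

/-- Pigeonhole on the hull bounds the exponents to be tested, so finitely many membership questions
suffice. -/
theorem IsHull.isCocycleWord_iff {V : List (List (α × Bool))} (hV : IsHull H {v | v ∈ V}) :
    IsCocycleWord H u ↔
      IsCyclicallyReduced u ∧ ∀ j < V.length, FreeGroup.mk (List.replicate (j + 1) u).flatten ∈ H → u = [] := by
  constructor
  · refine fun h => ⟨h.1, fun j _ hj => ?_⟩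
    rw [← h.1.isReduced.mk_eq_one_iff]
    exact isMeetCocycle_iff.1 h.2 (j + 1) j.succ_pos (by rwa [← mk_flatten_replicate])
  · refine fun ⟨hu, h⟩ => ⟨hu, isMeetCocycle_iff.2 fun k hk huk => ?_⟩
    rw [hu.isReduced.mk_eq_one_iff]
    have hr : ∀ i : ℕ, ∃ r : Fin V.length, FreeGroup.mk u ^ i * (FreeGroup.mk (V.get r))⁻¹ ∈ H := by
      intro i
      -- The `i`-th power is a prefix of the closed reduced walk `u ^ (k * i)`, so it ends in the
      -- hull.
      obtain ⟨t, ht⟩ := flatten_replicate_prefix u (Nat.le_mul_of_pos_left i hk)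
      have hred := (hu.flatten_replicate (k * i)).isReduced
      have hH : Leads H (List.replicate (k * i) u).flatten [] [] := by
        rw [leads_nil_nil, mk_flatten_replicate, pow_mul]
        exact pow_mem huk i
      rw [← ht] at hred hH
      obtain ⟨r, hr, hl⟩ := hV.exists_leads hV.nil_mem hV.nil_mem hred hH
      obtain ⟨n, rfl⟩ := List.get_of_mem hr
      refine ⟨n, ?_⟩
      rw [leads_iff, mk_flatten_replicate] at hl
      simpa [← one_eq_mk] using hl
    choose r hr using hr
    obtain ⟨i, j, hij, hrij⟩ := Fintype.exists_ne_map_eq_of_card_lt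
      (fun i : Fin (V.length + 1) => r i) (by simp)
    wlog hlt : i < j generalizing i j
    · exact this j i hij.symm hrij.symm (lt_of_le_of_ne (not_lt.1 hlt) hij.symm)
    have hlt' : (i : ℕ) < j := hlt
    refine h (j - i - 1) (by omega) ?_
    rw [mk_flatten_replicate, show (j : ℕ) - i - 1 + 1 = j - i by omega]
    have hj := hr j
    rw [← hrij] at hj
    convert! mul_mem hj (inv_mem (hr i)) using 1
    rw [pow_sub _ hlt'.le]
    group

end Hull

/-! ### The Stallings automaton and the criterion with `u ^ m`. -/

section Stallings

open FreeGroup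

variable {α : Type*} {H : Subgroup (FreeGroup α)} {u w : List (α × Bool)}

/-- The subgroup of a free group generated by a list of words. -/
abbrev wordClosure (gens : List (List (α × Bool))) : Subgroup (FreeGroup α) :=
  Subgroup.closure (FreeGroup.mk '' {w | w ∈ gens})

theorem exists_isHull (gens : List (List (α × Bool))) :
    ∃ V : List (List (α × Bool)), (∀ w ∈ gens, w ∈ V) ∧ [] ∈ V ∧
      ∀ v ∈ V, v.dropLast ∈ V := by
  -- All prefixes of generators; the empty word is added by hand in case there are no generators.
  refine ⟨[] :: gens.flatMap List.inits, ?_, by simp, ?_⟩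
  · intro w hw
    simp only [List.mem_cons, List.mem_flatMap, List.mem_inits]
    exact .inr ⟨w, hw, List.prefix_rfl⟩
  · simp only [List.mem_cons, List.mem_flatMap, List.mem_inits]
    rintro v (rfl | ⟨w, hw, hv⟩)
    · exact .inl rfl
    · exact .inr ⟨w, hw, (List.dropLast_prefix v).trans hv⟩

theorem isHull_wordClosure {gens V : List (List (α × Bool))} (hg : ∀ w ∈ gens, w ∈ V)
    (hn : [] ∈ V) (hd : ∀ v ∈ V, v.dropLast ∈ V) : IsHull (wordClosure gens) {v | v ∈ V} :=
  ⟨hn, hd, {w | w ∈ gens}, hg, rfl⟩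

theorem exists_wordClosure_eq (hH : H.FG) : ∃ gens : List (List (α × Bool)), wordClosure gens = H := by
  classical
  obtain ⟨S, rfl⟩ := hH
  refine ⟨S.toList.map toWord, congrArg Subgroup.closure (Set.ext fun g => ?_)⟩
  simp only [List.mem_map, Finset.mem_toList, Set.mem_image, Set.mem_ofPred_eq, SetLike.mem_coe]
  constructor
  · rintro ⟨_, ⟨x, hx, rfl⟩, rfl⟩
    rwa [mk_toWord]
  · exact fun hg => ⟨g.toWord, ⟨g, hg, rfl⟩, mk_toWord⟩

/-- The Schreier automaton is deterministic and complete: the representative chosen in a step does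
not matter, since right multiplication respects right cosets. -/
theorem schreierAutomaton_evalFrom (g : FreeGroup α) (w : List (α × Bool)) :
    (schreierAutomaton H).evalFrom {Quotient.mk _ g} w =
      {Quotient.mk (QuotientGroup.rightRel H) (g * FreeGroup.mk w)} := by
  induction w generalizing g with
  | nil => simp [← one_eq_mk]
  | cons a w ih =>
    have hs : (schreierAutomaton H).step (Quotient.mk _ g) a =
        {Quotient.mk (QuotientGroup.rightRel H) (g * FreeGroup.mk [a])} := by
      ext v
      constructor
      · rintro ⟨g', hg, rfl⟩
        rw [Set.mem_singleton_iff]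
        rw [Quotient.eq, QuotientGroup.rightRel_apply] at hg ⊢
        convert! inv_mem hg using 1
        group
      · rintro rfl
        exact ⟨g, rfl, rfl⟩
    rw [NFA.evalFrom_cons, NFA.stepSet_singleton, hs, ih, mul_assoc, mul_mk, List.singleton_append]

theorem mem_coreVertices_iff {v : Quotient (QuotientGroup.rightRel H)} :
    v ∈ coreVertices (schreierAutomaton H) ↔ ∃ w₁ w₂ : List (α × Bool),
      FreeGroup.IsReduced (w₁ ++ w₂) ∧ v = Quotient.mk _ (FreeGroup.mk w₁) ∧
        FreeGroup.mk (w₁ ++ w₂) ∈ H := by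
  have hs : (schreierAutomaton H).start = {Quotient.mk _ 1} := rfl
  have ha : (schreierAutomaton H).accept = {Quotient.mk _ 1} := rfl
  refine exists_congr fun w₁ => exists_congr fun w₂ => and_congr_right fun _ => ?_
  rw [hs, ha, schreierAutomaton_evalFrom, one_mul, Set.mem_singleton_iff]
  refine and_congr_right fun hv => ?_
  simp only [Set.mem_singleton_iff, exists_eq_left]
  rw [hv, schreierAutomaton_evalFrom, Set.mem_singleton_iff, Quotient.eq,
    QuotientGroup.rightRel_apply, inv_one, mul_one, mul_mk]

theorem finite_stallingsVertex (hH : H.FG) : Finite (StallingsVertex H) := by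
  obtain ⟨gens, rfl⟩ := exists_wordClosure_eq hH
  obtain ⟨V, hg, hn, hd⟩ := exists_isHull gens
  have hV := isHull_wordClosure hg hn hd
  refine Set.Finite.to_subtype (((List.finite_toSet V).image fun r =>
    Quotient.mk (QuotientGroup.rightRel (wordClosure gens)) (FreeGroup.mk r)).subset ?_)
  intro v hv
  obtain ⟨w₁, w₂, hred, rfl, hw⟩ := mem_coreVertices_iff.1 hv
  obtain ⟨r, hr, hl⟩ := hV.exists_leads hV.nil_mem hV.nil_mem hred (leads_nil_nil.2 hw)
  refine ⟨r, hr, ?_⟩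
  rw [Quotient.eq, QuotientGroup.rightRel_apply]
  rw [leads_iff] at hl
  simpa [← one_eq_mk] using hl

theorem stallingsAutomaton_mem_evalFrom {v : StallingsVertex H} :
    v ∈ (stallingsAutomaton H).evalFrom (stallingsAutomaton H).start w ↔
      v.1 = Quotient.mk _ (FreeGroup.mk w) ∧
        ∀ u, u <+: w → Quotient.mk _ (FreeGroup.mk u) ∈ coreVertices (schreierAutomaton H) := by
  induction w using List.reverseRecOn generalizing v with
  | nil =>
    simp only [List.prefix_nil, forall_eq, NFA.evalFrom_nil]
    change v.1 = Quotient.mk _ 1 ↔ _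
    rw [← one_eq_mk]
    exact ⟨fun h => ⟨h, h ▸ v.2⟩, fun h => h.1⟩
  | append_singleton w a ih =>
    rw [NFA.evalFrom_append, NFA.evalFrom_singleton, NFA.mem_stepSet]
    simp only [ih, List.prefix_concat_iff, forall_eq_or_imp]
    have hstep : ∀ t : StallingsVertex H, t.1 = Quotient.mk _ (FreeGroup.mk w) →
        (v ∈ (stallingsAutomaton H).step t a ↔
          v.1 = Quotient.mk _ (FreeGroup.mk (w ++ [a]))) := by
      intro t ht
      have := schreierAutomaton_evalFrom (H := H) (FreeGroup.mk w) [a]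
      rw [NFA.evalFrom_singleton, NFA.stepSet_singleton, ← ht] at this
      change v.1 ∈ (schreierAutomaton H).step t.1 a ↔ _
      rw [this, Set.mem_singleton_iff, mul_mk]
    constructor
    · rintro ⟨t, ⟨ht, hw⟩, hv⟩
      rw [hstep t ht] at hv
      exact ⟨hv, hv ▸ v.2, hw⟩
    · rintro ⟨hv, _, hw⟩
      refine ⟨⟨_, hw w List.prefix_rfl⟩, ⟨rfl, hw⟩, ?_⟩
      rwa [hstep _ rfl]

theorem isReadable_stallingsAutomaton_iff :
    IsReadable (stallingsAutomaton H) w ↔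
      ∀ u, u <+: w → Quotient.mk _ (FreeGroup.mk u) ∈ coreVertices (schreierAutomaton H) := by
  constructor
  · rintro ⟨v, hv⟩
    exact (stallingsAutomaton_mem_evalFrom.1 hv).2
  · exact fun h => ⟨⟨_, h w List.prefix_rfl⟩, stallingsAutomaton_mem_evalFrom.2 ⟨rfl, h⟩⟩

theorem isMeetCocycle_iff_not_isReadable [DecidableEq α] [Finite (StallingsVertex H)]
    {u : FreeGroup α} (hu : IsCyclicallyReduced u.toWord) (h1 : u ≠ 1) :
    IsMeetCocycle H u ↔
      ¬ IsReadable (stallingsAutomaton H) (u ^ Nat.card (StallingsVertex H)).toWord := by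
  have hpow : ∀ k : ℕ, (u ^ k).toWord = (List.replicate k u.toWord).flatten := by
    intro k
    rw [toWord_pow, (hu.flatten_replicate k).isReduced.reduce_eq]
  have hmk : ∀ k : ℕ, FreeGroup.mk (List.replicate k u.toWord).flatten = u ^ k := by
    intro k
    rw [mk_flatten_replicate, mk_toWord]
  rw [isReadable_stallingsAutomaton_iff, isMeetCocycle_iff, hpow]
  constructor
  · intro h hr
    have := Fintype.ofFinite (StallingsVertex H)
    -- The exponents `0, …, m` give `m + 1` cosets among `m` vertices.
    obtain ⟨i, j, hij, he⟩ := Fintype.exists_ne_map_eq_of_card_lt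
      (fun i : Fin (Nat.card (StallingsVertex H) + 1) => (⟨_, hr _ (flatten_replicate_prefix u.toWord
        (Nat.lt_succ_iff.1 i.2))⟩ : StallingsVertex H)) (by simp)
    wlog hlt : i < j generalizing i j
    · exact this j i hij.symm he.symm (lt_of_le_of_ne (not_lt.1 hlt) hij.symm)
    have hlt' : (i : ℕ) < j := hlt
    rw [Subtype.mk.injEq, Quotient.eq, QuotientGroup.rightRel_apply, hmk, hmk,
      ← pow_sub _ hlt'.le] at he
    exact h1 (h (j - i) (by omega) he)
  · intro h k hk hku
    -- If `u ^ k ∈ H`, then `u ^ m` is a prefix of the closed reduced walk `u ^ (k * m)`, all of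
    -- whose vertices are in the core.
    refine absurd (fun w hw => ?_) h
    obtain ⟨t, ht⟩ := hw.trans (flatten_replicate_prefix u.toWord (Nat.le_mul_of_pos_left _ hk))
    refine mem_coreVertices_iff.2 ⟨w, t, ?_, rfl, ?_⟩
    · rw [ht]
      exact (hu.flatten_replicate _).isReduced
    · rw [ht, hmk, pow_mul]
      exact pow_mem hku _

end Stallings

/-! ### Finiteness of the set of classes. -/

section Representatives

open FreeGroup

variable {α : Type*}

/-- Finitely many words represent all classes of reduced words with the same action. -/
theorem exists_representatives (H : Subgroup (FreeGroup α)) (V : List (List (α × Bool)))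
    {A : Set (α × Bool)} (hA : A.Finite) :
    ∃ S : List (List (α × Bool)), (∀ s ∈ S, FreeGroup.IsReduced s) ∧
      (∀ s ∈ S, ∀ a ∈ s, a ∈ A) ∧
      ∀ w, FreeGroup.IsReduced w → (∀ a ∈ w, a ∈ A) →
        ∃ s ∈ S, SameAction H {v | v ∈ V} s w := by
  classical
  let W : Set (List (α × Bool)) := {w | FreeGroup.IsReduced w ∧ ∀ a ∈ w, a ∈ A}
  let Φ (w : List (α × Bool)) : (Option (α × Bool) × Option (α × Bool)) ×
      Set (List (α × Bool) × List (α × Bool)) :=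
    ((w.head?, w.getLast?), {x | x.1 ∈ V ∧ x.2 ∈ V ∧ Leads H w x.1 x.2})
  have hO : (insert none (some '' A)).Finite := (hA.image _).insert _
  have hVV : ({v | v ∈ V} ×ˢ {v | v ∈ V}).Finite :=
    (List.finite_toSet V).prod (List.finite_toSet V)
  have hfin : (Φ '' W).Finite := by
    refine ((hO.prod hO).prod hVV.finite_subsets).subset ?_
    rintro _ ⟨w, ⟨-, hw⟩, rfl⟩
    refine ⟨⟨?_, ?_⟩, ?_⟩
    · rcases h : w.head? with _ | a
      · exact .inl h
      · exact .inr ⟨a, hw a (List.mem_of_head? h), h.symm⟩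
    · rcases h : w.getLast? with _ | a
      · exact .inl h
      · exact .inr ⟨a, hw a (List.mem_of_getLast? h), h.symm⟩
    · exact fun x hx => ⟨hx.1, hx.2.1⟩
  -- `Φ` records exactly the data of `SameAction` and has finite image, so a transversal of its
  -- fibres is a finite set of representatives.
  obtain ⟨T, hTW, hT⟩ := Set.exists_subset_bijOn W Φ
  have hTfin : T.Finite := Set.Finite.of_finite_image (hT.image_eq ▸ hfin) hT.injOn
  refine ⟨hTfin.toFinset.toList, fun s hs => ?_, fun s hs => ?_, fun w hw hwA => ?_⟩
  · exact (hTW (by simpa using hs)).1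
  · exact (hTW (by simpa using hs)).2
  · obtain ⟨s, hs, hsw⟩ := hT.surjOn ⟨w, ⟨hw, hwA⟩, rfl⟩
    refine ⟨s, by simpa using hs, ?_⟩
    simp only [Φ, Prod.mk.injEq] at hsw
    refine ⟨hsw.1.1, hsw.1.2, fun p hp q hq => ?_⟩
    have := Set.ext_iff.1 hsw.2 (p, q)
    simpa [show p ∈ V from hp, show q ∈ V from hq] using this

end Representatives

/-! ### Computable predicates, bounded quantifiers and unbounded search. -/

section Computability

variable {α β : Type*} [Primcodable α] [Primcodable β]

namespace ComputablePred

theorem preimage {p : β → Prop} {f : α → β} (hp : ComputablePred p) (hf : Computable f) :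
    ComputablePred fun a => p (f a) := by
  classical exact (hp.decide.comp hf).computablePred

theorem conj {p q : α → Prop} (hp : ComputablePred p) (hq : ComputablePred q) :
    ComputablePred fun a => p a ∧ q a := by
  classical
  exact ((Primrec.and.to_comp.comp hp.decide hq.decide).of_eq fun a => by simp).computablePred

theorem disj {p q : α → Prop} (hp : ComputablePred p) (hq : ComputablePred q) :
    ComputablePred fun a => p a ∨ q a := by
  classical
  exact ((Primrec.or.to_comp.comp hp.decide hq.decide).of_eq fun a => by simp).computablePred

theorem imp {p q : α → Prop} (hp : ComputablePred p) (hq : ComputablePred q) :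
    ComputablePred fun a => p a → q a :=
  (hp.not.disj hq).of_eq fun _ => imp_iff_not_or.symm

theorem iff {p q : α → Prop} (hp : ComputablePred p) (hq : ComputablePred q) :
    ComputablePred fun a => p a ↔ q a :=
  ((hp.imp hq).conj (hq.imp hp)).of_eq fun _ => iff_iff_implies_and_implies.symm

theorem eq {f g : α → β} (hf : Computable f) (hg : Computable g) :
    ComputablePred fun a => f a = g a := by
  classical exact (Primrec.eq (α := β)).computablePred.preimage (hf.pair hg)

theorem forall_mem {f : α → List β} {P : α → β → Prop} (hf : Computable f)
    (hP : ComputablePred fun x : α × β => P x.1 x.2) :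
    ComputablePred fun a => ∀ b ∈ f a, P a b := by
  classical
  have hd : Computable fun x : α × β => decide (P x.1 x.2) := hP.decide
  -- Conjunction over the first `n` positions; a position past the end counts as `true`.
  let g (a : α) : ℕ → Bool := fun n =>
    Nat.rec true (fun n c => c && (((f a)[n]?).map fun b => decide (P a b)).getD true) n
  have hg : Computable fun a => g a (f a).length := by
    refine Computable.nat_rec (h := fun a (p : ℕ × Bool) =>
      p.2 && (((f a)[p.1]?).map fun b => decide (P a b)).getD true)
      (Computable.list_length.comp hf) (Computable.const true) ?_
    refine Primrec.and.to_comp.comp (Computable.snd.comp Computable.snd)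
      (Computable.option_getD (Computable.option_map
        (Computable.list_getElem?.comp (hf.comp Computable.fst)
          (Computable.fst.comp Computable.snd)) ?_) (Computable.const true))
    have := Computable.comp (f := fun x : α × β => decide (P x.1 x.2))
      (g := fun x : (α × ℕ × Bool) × β => (x.1.1, x.2)) hd
      ((Computable.fst.comp Computable.fst).pair Computable.snd)
    exact this
  have key : ∀ a n, g a n = true ↔ ∀ i < n, ∀ b, (f a)[i]? = some b → P a b := by
    intro a n
    induction n with
    | zero => simp [g]
    | succ n ih =>
      have : g a (n + 1) = (g a n && (((f a)[n]?).map fun b => decide (P a b)).getD true) := rfl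
      rw [this, Bool.and_eq_true, ih]
      simp only [Nat.lt_succ_iff_lt_or_eq, or_imp, forall_and, forall_eq]
      refine and_congr_right fun _ => ?_
      rcases (f a)[n]? with _ | b <;> simp
  refine (computable_iff.2 ⟨_, hg, rfl⟩).of_eq fun a => ?_
  rw [key]
  constructor
  · intro h b hb
    obtain ⟨i, hi, rfl⟩ := List.getElem_of_mem hb
    exact h i hi _ (List.getElem?_eq_getElem hi)
  · exact fun h i _ b hb => h b (List.mem_of_getElem? hb)

theorem exists_mem {f : α → List β} {P : α → β → Prop} (hf : Computable f)
    (hP : ComputablePred fun x : α × β => P x.1 x.2) :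
    ComputablePred fun a => ∃ b ∈ f a, P a b :=
  (forall_mem (P := fun a b => ¬ P a b) hf hP.not).not.of_eq fun a => by push Not; rfl

theorem mem {f : α → List β} {g : α → β} (hf : Computable f) (hg : Computable g) :
    ComputablePred fun a => g a ∈ f a :=
  (exists_mem (P := fun a b => b = g a) hf (ComputablePred.eq (f := fun x : α × β => x.2) (g := fun x => g x.1)
    Computable.snd (hg.comp Computable.fst))).of_eq fun a => by simp

theorem forall_lt {f : α → ℕ} {P : α → ℕ → Prop} (hf : Computable f)
    (hP : ComputablePred fun x : α × ℕ => P x.1 x.2) :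
    ComputablePred fun a => ∀ i < f a, P a i :=
  (forall_mem (Primrec.list_range.to_comp.comp hf) hP).of_eq fun a => by simp

theorem exists_lt {f : α → ℕ} {P : α → ℕ → Prop} (hf : Computable f)
    (hP : ComputablePred fun x : α × ℕ => P x.1 x.2) :
    ComputablePred fun a => ∃ i < f a, P a i :=
  (exists_mem (Primrec.list_range.to_comp.comp hf) hP).of_eq fun a => by simp

theorem forall_bool {P : α → Bool → Prop} (hP : ComputablePred fun x : α × Bool => P x.1 x.2) :
    ComputablePred fun a => ∀ b, P a b :=
  (forall_mem (Computable.const [true, false]) hP).of_eq fun a => by simp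

/-- The projection of a computable relation is recursively enumerable. -/
theorem rePred_exists {P : α → β → Prop} (hP : ComputablePred fun x : α × β => P x.1 x.2) :
    REPred fun a => ∃ b, P a b := by
  classical
  have hd : Computable fun x : α × β => decide (P x.1 x.2) := hP.decide
  -- The search runs over codes; a number that decodes to nothing counts as a failure.
  let g (a : α) (n : ℕ) : Bool :=
    ((Encodable.decode (α := β) n).map fun b => decide (P a b)).getD false
  have hg : Computable₂ g := by
    refine Computable.option_getD (Computable.option_map
      (Computable.decode.comp Computable.snd) ?_) (Computable.const false)
    have := Computable.comp (f := fun x : α × β => decide (P x.1 x.2))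
      (g := fun x : (α × ℕ) × β => (x.1.1, x.2)) hd
      ((Computable.fst.comp Computable.fst).pair Computable.snd)
    exact this
  have h : Partrec fun a => Nat.rfind fun n => Part.some (g a n) := Partrec.rfind hg.partrec₂
  refine h.dom_re.of_eq fun a => ?_
  refine Nat.rfind_dom.trans ?_
  constructor
  · rintro ⟨n, hn, -⟩
    have hn : true = g a n := by simpa using hn
    rcases hd : Encodable.decode (α := β) n with _ | b
    · simp [g, hd] at hn
    · exact ⟨b, by simpa [g, hd] using hn⟩
  · rintro ⟨b, hb⟩
    exact ⟨Encodable.encode b, by simp [g, hb], by simp⟩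

/-- Unbounded search: a total computable relation contains a computable function. -/
theorem exists_computable {P : α → β → Prop} [Inhabited β]
    (hP : ComputablePred fun x : α × β => P x.1 x.2) (hex : ∀ a, ∃ b, P a b) :
    ∃ f : α → β, Computable f ∧ ∀ a, P a (f a) := by
  classical
  let d (n : ℕ) : β := (Encodable.decode n).getD default
  have hd : Computable d := Computable.option_getD Computable.decode (Computable.const _)
  have hde : ∀ b, d (Encodable.encode b) = b := fun b => by simp [d]
  have hex' : ∀ a, ∃ n, P a (d n) := fun a => by
    obtain ⟨b, hb⟩ := hex a
    exact ⟨Encodable.encode b, by rwa [hde]⟩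
  exact ⟨fun a => d (Nat.find (hex' a)), hd.comp (Computable.find
    (hP.preimage (Computable.fst.pair (hd.comp Computable.snd))) hex'),
    fun a => Nat.find_spec (hex' a)⟩

end ComputablePred

theorem primrec_reduce : Primrec (FreeGroup.reduce : List (ℕ × Bool) → List (ℕ × Bool)) := by
  have h : Primrec fun w : List (ℕ × Bool) =>
      w.foldr (fun x (l : List (ℕ × Bool)) => (l.head?.map fun y =>
        if x.1 = y.1 ∧ x.2 = !y.2 then l.tail else x :: l).getD [x]) [] := by
    refine Primrec.list_foldr (h := fun _ (p : (ℕ × Bool) × List (ℕ × Bool)) =>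
      (p.2.head?.map fun y => if p.1.1 = y.1 ∧ p.1.2 = !y.2 then p.2.tail else p.1 :: p.2).getD
        [p.1]) Primrec.id (Primrec.const []) ?_
    have hp : Primrec fun x : (List (ℕ × Bool)) × ((ℕ × Bool) × List (ℕ × Bool)) => x.2 :=
      Primrec.snd
    refine Primrec.option_getD.comp (Primrec.option_map
      (Primrec.list_head?.comp (Primrec.snd.comp hp)) ?_)
      (Primrec.list_cons.comp (Primrec.fst.comp hp) (Primrec.const []))
    have hq := hp.comp (Primrec.fst (β := ℕ × Bool))
    refine Primrec.ite (PrimrecPred.and ?_ ?_) (Primrec.list_tail.comp (Primrec.snd.comp hq))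
      (Primrec.list_cons.comp (Primrec.fst.comp hq) (Primrec.snd.comp hq))
    · exact Primrec.eq.comp (Primrec.fst.comp (Primrec.fst.comp hq))
        (Primrec.fst.comp Primrec.snd)
    · exact Primrec.eq.comp (Primrec.snd.comp (Primrec.fst.comp hq))
        (Primrec.not.comp (Primrec.snd.comp Primrec.snd))
  refine h.of_eq fun w => ?_
  induction w with
  | nil => rfl
  | cons x w ih =>
    rw [List.foldr_cons, ih, FreeGroup.reduce.cons]
    rcases FreeGroup.reduce w with _ | ⟨y, l⟩ <;> simp

theorem primrec_invRev : Primrec (FreeGroup.invRev : List (ℕ × Bool) → List (ℕ × Bool)) :=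
  Primrec.list_reverse.comp (Primrec.list_map Primrec.id
    ((Primrec.fst.comp Primrec.snd).pair (Primrec.not.comp (Primrec.snd.comp Primrec.snd))).to₂)

theorem primrec_foldr₂ {σ : Type*} [Primcodable σ] {f : α → List β} {g : α → σ}
    {h : α → β → σ → σ} (hf : Primrec f) (hg : Primrec g)
    (hh : Primrec fun x : α × β × σ => h x.1 x.2.1 x.2.2) :
    Primrec fun a => (f a).foldr (h a) (g a) :=
  Primrec.list_foldr (h := fun a p => h a p.1 p.2) hf hg hh

end Computability

/-! ### Decidability of membership in finitely generated subgroups. -/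

section Membership

/-- The permutation of `ℕ` that a list of labelled transpositions assigns to a letter. -/
def letterPerm (l : List (ℕ × ℕ × ℕ)) (i : ℕ) : Equiv.Perm ℕ :=
  (l.map fun t => if t.1 = i then Equiv.swap t.2.1 t.2.2 else (1 : Equiv.Perm ℕ)).prod

/-- The action of a labelled transposition under the letter `i`. -/
def swapAct (i : ℕ) (t : ℕ × ℕ × ℕ) (y : ℕ) : ℕ :=
  if t.1 = i then (if y = t.2.1 then t.2.2 else if y = t.2.2 then t.2.1 else y) else y

/-- The action of a signed letter given by a list of labelled transpositions. -/
def letterAct (l : List (ℕ × ℕ × ℕ)) (a : ℕ × Bool) (y : ℕ) : ℕ :=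
  (if a.2 = true then l else l.reverse).foldr (swapAct a.1) y

theorem swapAct_eq (i : ℕ) (t : ℕ × ℕ × ℕ) (y : ℕ) :
    swapAct i t y = (if t.1 = i then Equiv.swap t.2.1 t.2.2 else (1 : Equiv.Perm ℕ)) y := by
  unfold swapAct
  split_ifs with h <;> simp_all [Equiv.swap_apply_def]

theorem foldr_swapAct (l : List (ℕ × ℕ × ℕ)) (i y : ℕ) :
    l.foldr (swapAct i) y = letterPerm l i y := by
  induction l with
  | nil => rfl
  | cons t l ih =>
    rw [List.foldr_cons, ih, swapAct_eq, letterPerm, letterPerm, List.map_cons, List.prod_cons]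
    rfl

/-- Every factor is an involution, so reversing the product inverts it. -/
theorem letterPerm_reverse (l : List (ℕ × ℕ × ℕ)) (i : ℕ) :
    letterPerm l.reverse i = (letterPerm l i)⁻¹ := by
  rw [letterPerm, letterPerm, List.prod_inv_reverse, List.map_reverse, List.map_map]
  congr 3
  ext1 t
  simp only [Function.comp_apply]
  split_ifs <;> simp

theorem foldr_letterAct (l : List (ℕ × ℕ × ℕ)) (w : List (ℕ × Bool)) (x : ℕ) :
    w.foldr (letterAct l) x = FreeGroup.lift (letterPerm l) (FreeGroup.mk w) x := by
  rw [FreeGroup.lift_mk]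
  induction w with
  | nil => rfl
  | cons a w ih =>
    rw [List.foldr_cons, ih, List.map_cons, List.prod_cons, Equiv.Perm.mul_apply, letterAct,
      foldr_swapAct]
    rcases a with ⟨i, _ | _⟩ <;> simp [letterPerm_reverse]

theorem primrec_foldr_letterAct :
    Primrec fun x : List (ℕ × ℕ × ℕ) × List (ℕ × Bool) × ℕ => x.2.1.foldr (letterAct x.1) x.2.2 := by
  have hs : Primrec fun x : ℕ × (ℕ × ℕ × ℕ) × ℕ => swapAct x.1 x.2.1 x.2.2 := by
    have ht : Primrec fun x : ℕ × (ℕ × ℕ × ℕ) × ℕ => x.2.1 := Primrec.fst.comp Primrec.snd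
    have hy : Primrec fun x : ℕ × (ℕ × ℕ × ℕ) × ℕ => x.2.2 := Primrec.snd.comp Primrec.snd
    have h1 := Primrec.fst.comp (Primrec.snd.comp ht)
    have h2 := Primrec.snd.comp (Primrec.snd.comp ht)
    exact Primrec.ite (Primrec.eq.comp (Primrec.fst.comp ht) Primrec.fst)
      (Primrec.ite (Primrec.eq.comp hy h1) h2 (Primrec.ite (Primrec.eq.comp hy h2) h1 hy)) hy
  have hl : Primrec fun x : List (ℕ × ℕ × ℕ) × (ℕ × Bool) × ℕ => letterAct x.1 x.2.1 x.2.2 := by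
    refine primrec_foldr₂ (Primrec.ite (Primrec.eq.comp (Primrec.snd.comp (Primrec.fst.comp
      Primrec.snd)) (Primrec.const true)) Primrec.fst (Primrec.list_reverse.comp Primrec.fst))
      (Primrec.snd.comp Primrec.snd) ?_
    exact hs.comp (Primrec.pair (Primrec.fst.comp (Primrec.fst.comp (Primrec.snd.comp
      Primrec.fst))) Primrec.snd)
  refine primrec_foldr₂ (Primrec.fst.comp Primrec.snd) (Primrec.snd.comp Primrec.snd) ?_
  exact hl.comp (Primrec.pair (Primrec.fst.comp Primrec.fst) Primrec.snd)

theorem computable_foldr_letterAct {α : Type*} [Primcodable α] {f : α → List (ℕ × ℕ × ℕ)}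
    {g : α → List (ℕ × Bool)} {h : α → ℕ} (hf : Computable f) (hg : Computable g)
    (hh : Computable h) : Computable fun a => (g a).foldr (letterAct (f a)) (h a) :=
  primrec_foldr_letterAct.to_comp.comp (hf.pair (hg.pair hh))

/-- Permutations of a finite set of natural numbers, one for each of finitely many letters, can
be realized by a list of labelled transpositions. -/
theorem exists_letterPerm {S : Type*} [Finite S] (e : S ↪ ℕ) (π : ℕ → Equiv.Perm S) (K : ℕ) :
    ∃ l, ∀ i < K, ∀ x, letterPerm l i (e x) = e (π i x) := by
  classical
  have h1 : ∀ f : Equiv.Perm S, ∃ l : List (ℕ × ℕ),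
      ∀ x, (l.map fun t => Equiv.swap t.1 t.2).prod (e x) = e (f x) := by
    intro f
    induction f using Equiv.Perm.swap_induction_on with
    | one => exact ⟨[], fun x => rfl⟩
    | swap_mul f x y _ ih =>
      obtain ⟨l, hl⟩ := ih
      refine ⟨(e x, e y) :: l, fun z => ?_⟩
      rw [List.map_cons, List.prod_cons, Equiv.Perm.mul_apply, hl, Equiv.Perm.mul_apply,
        ← e.injective.map_swap]
  -- Strengthened so that letters from `K` on act trivially: transpositions for the letter `K` can
  -- then be added without interference.
  have h2 : ∃ l, (∀ i < K, ∀ x, letterPerm l i (e x) = e (π i x)) ∧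
      ∀ i, K ≤ i → letterPerm l i = 1 := by
    induction K with
    | zero => exact ⟨[], by simp, fun i _ => rfl⟩
    | succ K ih =>
      obtain ⟨l, hl, hl'⟩ := ih
      obtain ⟨m, hm⟩ := h1 (π K)
      have happ : ∀ i, letterPerm (m.map (Prod.mk K) ++ l) i =
          (if K = i then (m.map fun t => Equiv.swap t.1 t.2).prod else (1 : Equiv.Perm ℕ)) * letterPerm l i := by
        intro i
        rw [letterPerm, List.map_append, List.prod_append, List.map_map]
        congr 1
        split_ifs with h
        · simp [h, Function.comp_def]
        · simp [h, Function.comp_def]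
      refine ⟨m.map (Prod.mk K) ++ l, fun i hi x => ?_, fun i hi => ?_⟩
      · rw [happ]
        rcases Nat.lt_succ_iff_lt_or_eq.1 hi with hi | rfl
        · rw [if_neg hi.ne', one_mul, hl i hi]
        · rw [if_pos rfl, hl' i le_rfl, mul_one, hm]
      · rw [happ, if_neg (by omega), one_mul, hl' i (by omega)]
  exact h2.imp fun l h => h.1

/-- A partial injection of a finite set that is given by the action of a group element extends to
a permutation. -/
theorem exists_perm_smul {G X : Type*} [Group G] [MulAction G X] {S : Set X} (hS : S.Finite)
    (g : G) : ∃ π : Equiv.Perm S, ∀ x : S, g • x.1 ∈ S → (π x).1 = g • x.1 := by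
  classical
  have := hS.fintype
  obtain ⟨f, hf⟩ := Finset.exists_equiv_extend_of_card_eq (α := S) (t := hS.toFinset)
    (s := Finset.univ.filter fun x => g • x.1 ∈ S) (f := fun x => g • x.1)
    (by rw [← Set.toFinset_card]; congr 1; ext; simp) (by
      intro y hy
      obtain ⟨x, hx, rfl⟩ := Finset.mem_image.1 hy
      simpa using hx)
    (fun x _ y _ h => Subtype.ext (MulAction.injective g h))
  refine ⟨f.trans (Equiv.subtypeEquivRight fun x => by simp), fun x hx => ?_⟩
  simpa using hf x (by simpa using hx)

/-- Marshall Hall's theorem: an element outside a finitely generated subgroup of a free group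
is separated from it by an action on a finite set. -/
theorem exists_separating_action {gens : List (List (ℕ × Bool))} {w : List (ℕ × Bool)}
    (hw : FreeGroup.mk w ∉ wordClosure gens) :
    ∃ l x, (∀ g ∈ gens, g.foldr (letterAct l) x = x) ∧ w.foldr (letterAct l) x ≠ x := by
  classical
  set H := wordClosure gens
  -- Suffixes, because `foldr` applies the last letter first: acting on left cosets from the base
  -- coset, a word passes through the cosets of its suffixes. Only this finite part of the action is
  -- kept, and each letter is completed to a permutation of it.
  let T : Set (List (ℕ × Bool)) := {t | ∃ g ∈ w :: gens, t <:+ g}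
  have hT : T.Finite := by
    refine ((w :: gens).flatMap List.tails).finite_toSet.subset ?_
    rintro t ⟨g, hg, ht⟩
    exact List.mem_flatMap.2 ⟨g, hg, (List.mem_tails _ _).2 ht⟩
  let S : Set (FreeGroup ℕ ⧸ H) := (fun t => (FreeGroup.mk t : FreeGroup ℕ ⧸ H)) '' T
  have hS : S.Finite := hT.image _
  have := hS.to_subtype
  choose π hπ using fun i : ℕ => exists_perm_smul hS (FreeGroup.of i)
  obtain ⟨K, hK⟩ : ∃ K, ∀ t ∈ T, ∀ a ∈ t, a.1 < K := by
    obtain ⟨K, hK⟩ := (((w :: gens).flatten.map Prod.fst).finite_toSet).bddAbove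
    refine ⟨K + 1, ?_⟩
    rintro t ⟨g, hg, ht⟩ a ha
    refine Nat.lt_succ_of_le (hK ?_)
    exact List.mem_map.2 ⟨a, List.mem_flatten.2 ⟨g, hg, ht.subset ha⟩, rfl⟩
  obtain ⟨n, ⟨e⟩⟩ := Finite.exists_equiv_fin S
  let ι : S ↪ ℕ := e.toEmbedding.trans Fin.valEmbedding
  obtain ⟨l, hl⟩ := exists_letterPerm ι π K
  have hmem : ∀ t ∈ T, (FreeGroup.mk t : FreeGroup ℕ ⧸ H) ∈ S := fun t ht => ⟨t, ht, rfl⟩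
  have hnil : [] ∈ T := ⟨w, by simp, List.nil_suffix⟩
  have hact : ∀ t (ht : t ∈ T),
      t.foldr (letterAct l) (ι ⟨_, hmem [] hnil⟩) = ι ⟨_, hmem t ht⟩ := by
    intro t ht
    induction t with
    | nil => rfl
    | cons a t ih =>
      have ht' : t ∈ T := by
        obtain ⟨g, hg, h⟩ := ht
        exact ⟨g, hg, (List.suffix_cons a t).trans h⟩
      have haK := hK _ ht a (by simp)
      rw [List.foldr_cons, ih ht', letterAct, foldr_swapAct]
      have hcons : (FreeGroup.mk (a :: t) : FreeGroup ℕ ⧸ H) =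
          FreeGroup.mk [a] • (FreeGroup.mk t : FreeGroup ℕ ⧸ H) := by
        rw [← List.singleton_append, ← FreeGroup.mul_mk]
        rfl
      rcases a with ⟨i, _ | _⟩
      · simp only [Bool.false_eq_true, if_false]
        rw [letterPerm_reverse, Equiv.Perm.inv_eq_iff_eq, hl i haK]
        congr 1
        apply Subtype.ext
        have : FreeGroup.of i • (FreeGroup.mk ((i, false) :: t) : FreeGroup ℕ ⧸ H) =
            FreeGroup.mk t := by
          rw [hcons, smul_smul, show FreeGroup.of i * FreeGroup.mk [(i, false)] = 1 from
            mul_inv_cancel (FreeGroup.of i), one_smul]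
        rw [hπ i ⟨_, hmem _ ht⟩ (by rw [this]; exact hmem t ht'), this]
      · simp only [if_true]
        rw [hl i haK]
        congr 1
        apply Subtype.ext
        rw [hπ i ⟨_, hmem _ ht'⟩ (by
          rw [show FreeGroup.of i = FreeGroup.mk [(i, true)] from rfl, ← hcons]
          exact hmem _ ht)]
        exact hcons.symm
  refine ⟨l, ι ⟨_, hmem [] hnil⟩, fun g hg => ?_, fun h => hw ?_⟩
  · rw [hact g ⟨g, by simp [hg], List.suffix_rfl⟩]
    congr 1
    apply Subtype.ext
    refine QuotientGroup.eq.2 ?_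
    rw [← FreeGroup.one_eq_mk, mul_one]
    exact inv_mem (Subgroup.subset_closure ⟨g, hg, rfl⟩)
  · rw [hact w ⟨w, by simp, List.suffix_rfl⟩] at h
    have := QuotientGroup.eq.1 (Subtype.ext_iff.1 (ι.injective h))
    rw [← FreeGroup.one_eq_mk, mul_one] at this
    exact inv_mem_iff.1 this

/-- Non-membership has a finite witness. Soundness holds because the stabilizer of a point fixed by
the generators contains the whole subgroup. -/
theorem mk_notMem_wordClosure_iff {gens : List (List (ℕ × Bool))} {w : List (ℕ × Bool)} :
    FreeGroup.mk w ∉ wordClosure gens ↔ ∃ z : List (ℕ × ℕ × ℕ) × ℕ,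
      (∀ g ∈ gens, g.foldr (letterAct z.1) z.2 = z.2) ∧ w.foldr (letterAct z.1) z.2 ≠ z.2 := by
  constructor
  · intro h
    obtain ⟨l, x, h⟩ := exists_separating_action h
    exact ⟨(l, x), h⟩
  · rintro ⟨⟨l, x⟩, hg, hw⟩ h
    simp only [foldr_letterAct] at hg hw
    refine hw ?_
    have hle : wordClosure gens ≤
        (MulAction.stabilizer (Equiv.Perm ℕ) x).comap (FreeGroup.lift (letterPerm l)) := by
      rw [Subgroup.closure_le]
      rintro _ ⟨g, hgm, rfl⟩
      exact hg g hgm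
    exact hle h

theorem flatten_map_invRev_reverse {α : Type*} (z : List (List (α × Bool))) :
    (z.map FreeGroup.invRev).reverse.flatten = FreeGroup.invRev z.flatten := by
  induction z with
  | nil => rfl
  | cons y z ih => simp [ih, FreeGroup.invRev_append]

theorem mk_mem_wordClosure_iff {gens : List (List (ℕ × Bool))} {w : List (ℕ × Bool)} :
    FreeGroup.mk w ∈ wordClosure gens ↔ ∃ z : List (List (ℕ × Bool)),
      (∀ y ∈ z, y ∈ gens ∨ FreeGroup.invRev y ∈ gens) ∧
        FreeGroup.reduce z.flatten = FreeGroup.reduce w := by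
  constructor
  · suffices h : ∀ g ∈ wordClosure gens, ∃ z : List (List (ℕ × Bool)),
        (∀ y ∈ z, y ∈ gens ∨ FreeGroup.invRev y ∈ gens) ∧ FreeGroup.mk z.flatten = g by
      intro hw
      obtain ⟨z, hz, he⟩ := h _ hw
      exact ⟨z, hz, FreeGroup.reduce.sound he⟩
    intro g hg
    induction hg using Subgroup.closure_induction with
    | mem x hx =>
      obtain ⟨y, hy, rfl⟩ := hx
      exact ⟨[y], by simpa using .inl hy, by simp⟩
    | one => exact ⟨[], by simp, rfl⟩
    | mul x y _ _ hx hy =>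
      obtain ⟨z, hz, rfl⟩ := hx
      obtain ⟨z', hz', rfl⟩ := hy
      refine ⟨z ++ z', fun y hy => ?_, by simp⟩
      exact (List.mem_append.1 hy).elim (hz y) (hz' y)
    | inv x _ hx =>
      obtain ⟨z, hz, rfl⟩ := hx
      refine ⟨(z.map FreeGroup.invRev).reverse, fun y hy => ?_, ?_⟩
      · simp only [List.mem_reverse, List.mem_map] at hy
        obtain ⟨y, hy, rfl⟩ := hy
        rw [FreeGroup.invRev_invRev]
        exact (hz y hy).symm
      · rw [FreeGroup.inv_mk]
        exact congrArg _ (flatten_map_invRev_reverse z)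
  · rintro ⟨z, hz, he⟩
    rw [← FreeGroup.reduce.exact he]
    clear he
    induction z with
    | nil => exact one_mem _
    | cons y z ih =>
      rw [List.flatten_cons, ← FreeGroup.mul_mk]
      refine mul_mem ?_ (ih fun x hx => hz x (by simp [hx]))
      rcases hz y (by simp) with h | h
      · exact Subgroup.subset_closure ⟨y, h, rfl⟩
      · rw [← inv_mem_iff, FreeGroup.inv_mk]
        exact Subgroup.subset_closure ⟨_, h, rfl⟩

/-- The generalized word problem of free groups is decidable. -/
theorem computablePred_mem_wordClosure :
    ComputablePred fun x : List (List (ℕ × Bool)) × List (ℕ × Bool) =>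
      FreeGroup.mk x.2 ∈ wordClosure x.1 := by
  -- Post's theorem.
  rw [ComputablePred.computable_iff_re_compl_re']
  constructor
  · refine REPred.of_eq (ComputablePred.rePred_exists ?_) fun x => mk_mem_wordClosure_iff.symm
    refine ComputablePred.conj (ComputablePred.forall_mem Computable.snd ?_) ?_
    · exact (ComputablePred.mem (Computable.fst.comp (Computable.fst.comp Computable.fst))
        Computable.snd).disj
        (ComputablePred.mem (Computable.fst.comp (Computable.fst.comp Computable.fst))
        (primrec_invRev.to_comp.comp Computable.snd))
    · have hf : Computable fun x : (List (List (ℕ × Bool)) × List (ℕ × Bool)) ×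
          List (List (ℕ × Bool)) => x.2.flatten := Primrec.list_flatten.to_comp.comp Computable.snd
      have hg : Computable fun x : (List (List (ℕ × Bool)) × List (ℕ × Bool)) ×
          List (List (ℕ × Bool)) => x.1.2 := Computable.snd.comp Computable.fst
      exact ComputablePred.eq (primrec_reduce.to_comp.comp hf) (primrec_reduce.to_comp.comp hg)
  · refine REPred.of_eq (ComputablePred.rePred_exists ?_) fun x => mk_notMem_wordClosure_iff.symm
    refine ComputablePred.conj (ComputablePred.forall_mem (Computable.fst.comp Computable.fst) ?_)
      (ComputablePred.not ?_)
    · have hz : Computable fun x : ((List (List (ℕ × Bool)) × List (ℕ × Bool)) ×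
          List (ℕ × ℕ × ℕ) × ℕ) × List (ℕ × Bool) => x.1.2 := Computable.snd.comp Computable.fst
      exact ComputablePred.eq (computable_foldr_letterAct (Computable.fst.comp hz)
        Computable.snd (Computable.snd.comp hz)) (Computable.snd.comp hz)
    · exact ComputablePred.eq (computable_foldr_letterAct (Computable.fst.comp Computable.snd)
        (Computable.snd.comp Computable.fst) (Computable.snd.comp Computable.snd))
        (Computable.snd.comp Computable.snd)

end Membership

/-! ### Certified automata and their computation. -/

section Certificate

open FreeGroup

/-- The only new adjacency in `w ++ w` is that of the last and first letters. This makes cyclic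
reducedness testable by `reduce`. -/
theorem FreeGroup.isCyclicallyReduced_iff_append_self {α : Type*} {w : List (α × Bool)} :
    IsCyclicallyReduced w ↔ FreeGroup.IsReduced (w ++ w) := by
  rw [isCyclicallyReduced_iff, FreeGroup.IsReduced, FreeGroup.IsReduced, List.isChain_append]
  tauto

/-- A test for being a word of a cyclically reduced `∩`-cocycle that uses finitely many membership
problems. -/
def CocycleTest (gens V : List (List (ℕ × Bool))) (u : List (ℕ × Bool)) : Prop :=
  FreeGroup.IsReduced (u ++ u) ∧ ∀ j < V.length,
    FreeGroup.mk (List.replicate (j + 1) u).flatten ∈ wordClosure gens → u = []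

/-- `S` is a list of words that represent the states of the automaton `c`, which recognizes the
words of the cyclically reduced `∩`-cocycles of the subgroup generated by `gens`, and `V` is a hull
of this subgroup. -/
structure Certifies (n : ℕ) (gens : List (List (ℕ × Bool))) (c : AutomatonCode)
    (S V : List (List (ℕ × Bool))) : Prop where
  nil_mem : [] ∈ V
  dropLast_mem : ∀ v ∈ V, v.dropLast ∈ V
  gens_mem : ∀ g ∈ gens, g ∈ V
  length_eq : c.1 = S.length
  nil_mem_states : [] ∈ S
  isReduced : ∀ s ∈ S, FreeGroup.IsReduced s
  start_iff : ∀ i < c.1, (i ∈ c.2.1 ↔ S.getD i [] = [])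
  accept_iff : ∀ i < c.1, (i ∈ c.2.2.1 ↔ CocycleTest gens V (S.getD i []))
  arc : ∀ i < c.1, ∀ j < c.1, ∀ k < n, ∀ b, (i, (k, b), j) ∈ c.2.2.2 →
    FreeGroup.IsReduced (S.getD i [] ++ [(k, b)]) ∧
      SameAction (wordClosure gens) {v | v ∈ V} (S.getD j []) (S.getD i [] ++ [(k, b)])
  exists_arc : ∀ i < c.1, ∀ k < n, ∀ b, FreeGroup.IsReduced (S.getD i [] ++ [(k, b)]) →
    ∃ j < c.1, (i, (k, b), j) ∈ c.2.2.2

theorem exists_certifies (n : ℕ) (gens : List (List (ℕ × Bool))) :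
    ∃ c S V, Certifies n gens c S V := by
  classical
  obtain ⟨V, hg, hn, hd⟩ := exists_isHull gens
  have hA : {a : ℕ × Bool | a.1 < n}.Finite := by
    refine ((Set.finite_lt_nat n).prod (Set.finite_univ (α := Bool))).subset ?_
    exact fun a ha => ⟨ha, trivial⟩
  obtain ⟨S, hS, hSA, hrep⟩ := exists_representatives (wordClosure gens) V hA
  let arcs : Set (ℕ × (ℕ × Bool) × ℕ) := {x | (x.1 < S.length ∧ x.2.1.1 < n ∧ x.2.2 < S.length) ∧
    FreeGroup.IsReduced (S.getD x.1 [] ++ [x.2.1]) ∧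
      SameAction (wordClosure gens) {v | v ∈ V} (S.getD x.2.2 []) (S.getD x.1 [] ++ [x.2.1])}
  have harcs : arcs.Finite := by
    refine ((Set.finite_lt_nat S.length).prod (hA.prod (Set.finite_lt_nat S.length))).subset ?_
    exact fun x hx => hx.1
  refine ⟨(S.length, (List.range S.length).filter fun i => S.getD i [] = [],
    (List.range S.length).filter fun i => CocycleTest gens V (S.getD i []),
    harcs.toFinset.toList), S, V, hn, hd, hg, rfl, ?_, hS, ?_, ?_, ?_, ?_⟩
  · obtain ⟨s, hs, h⟩ := hrep [] .nil (by simp)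
    rwa [h.eq_nil_iff.2 rfl] at hs
  · intro i hi
    simpa using fun _ => hi
  · intro i hi
    simpa using fun _ => hi
  · intro i _ j _ k _ b h
    have h : (i, (k, b), j) ∈ arcs := by simpa using h
    exact h.2
  · intro i hi k hk b h
    have hmem : S.getD i [] ∈ S := by
      rw [List.getD_eq_getElem _ _ hi]
      exact List.getElem_mem _
    obtain ⟨s, hs, hsw⟩ := hrep _ h (by
      intro a ha
      rcases List.mem_append.1 ha with ha | ha
      · exact hSA _ hmem a ha
      · rw [List.mem_singleton.1 ha]
        exact hk)
    obtain ⟨j, hj, rfl⟩ := List.getElem_of_mem hs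
    refine ⟨j, hj, ?_⟩
    have : (i, (k, b), j) ∈ arcs :=
      ⟨⟨hi, hk, hj⟩, h, by rwa [List.getD_eq_getElem _ _ hj]⟩
    simpa using this

/-- The word over the letters of the free group on `ℕ` that is given by a word over the letters
of a free group of finite rank. -/
def natWord {n : ℕ} (w : List (Fin n × Bool)) : List (ℕ × Bool) :=
  w.map fun a => ((a.1 : ℕ), a.2)

variable {n : ℕ}

theorem natWord_append (u w : List (Fin n × Bool)) :
    natWord (u ++ w) = natWord u ++ natWord w := List.map_append

theorem isReduced_natWord {w : List (Fin n × Bool)} :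
    FreeGroup.IsReduced (natWord w) ↔ FreeGroup.IsReduced w := by
  simp only [FreeGroup.IsReduced, natWord, List.isChain_map, Fin.val_inj]

theorem mk_natWord (w : List (Fin n × Bool)) :
    FreeGroup.mk (natWord w) = FreeGroup.map Fin.val (FreeGroup.mk w) := FreeGroup.map.mk.symm

theorem wordClosure_encodeWords (gens : List (List (Fin n × Bool))) :
    wordClosure (encodeWords gens) = (subgroupOfWords gens).map (FreeGroup.map Fin.val) := by
  rw [subgroupOfWords, MonoidHom.map_closure, wordClosure]
  congr 1
  ext g
  constructor
  · rintro ⟨_, hw, rfl⟩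
    obtain ⟨w, hwg, rfl⟩ := List.mem_map.1 hw
    exact ⟨_, ⟨w, hwg, rfl⟩, (mk_natWord w).symm⟩
  · rintro ⟨_, ⟨w, hw, rfl⟩, rfl⟩
    exact ⟨natWord w, List.mem_map_of_mem hw, mk_natWord w⟩

/-- Computations take place in the free group on `ℕ`, uniformly in `n`; the embedding of the free
group of rank `n` is injective, so nothing changes. -/
theorem isCocycleWord_natWord {gens : List (List (Fin n × Bool))} {w : List (Fin n × Bool)} :
    IsCocycleWord (wordClosure (encodeWords gens)) (natWord w) ↔
      IsCocycleWord (subgroupOfWords gens) w := by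
  have hinj : Function.Injective (FreeGroup.map (Fin.val : Fin n → ℕ)) :=
    FreeGroup.map_injective Fin.val_injective
  have h : IsMeetCocycle (wordClosure (encodeWords gens)) (FreeGroup.mk (natWord w)) ↔
      IsMeetCocycle (subgroupOfWords gens) (FreeGroup.mk w) := by
    rw [isMeetCocycle_iff, isMeetCocycle_iff, mk_natWord, wordClosure_encodeWords]
    refine forall_congr' fun k => imp_congr_right fun _ => ?_
    rw [← map_pow, Subgroup.mem_map_iff_mem hinj, map_eq_one_iff _ hinj]
  have h' : IsCyclicallyReduced (natWord w) ↔ IsCyclicallyReduced w := by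
    rw [isCyclicallyReduced_iff_append_self, isCyclicallyReduced_iff_append_self,
      ← natWord_append, isReduced_natWord]
  exact ⟨fun hw => ⟨h'.1 hw.1, h.1 hw.2⟩, fun hw => ⟨h'.2 hw.1, h.2 hw.2⟩⟩

namespace Certifies

variable {gens : List (List (ℕ × Bool))} {c : AutomatonCode} {S V : List (List (ℕ × Bool))}

theorem isHull (h : Certifies n gens c S V) : IsHull (wordClosure gens) {v | v ∈ V} :=
  isHull_wordClosure h.gens_mem h.nil_mem h.dropLast_mem

theorem cocycleTest_iff (h : Certifies n gens c S V) {u : List (ℕ × Bool)} :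
    CocycleTest gens V u ↔ IsCocycleWord (wordClosure gens) u := by
  rw [h.isHull.isCocycleWord_iff, isCyclicallyReduced_iff_append_self]
  rfl

theorem isReduced_getD (h : Certifies n gens c S V) (i : ℕ) :
    FreeGroup.IsReduced (S.getD i []) := by
  rcases lt_or_ge i S.length with hi | hi
  · rw [List.getD_eq_getElem _ _ hi]
    exact h.isReduced _ (List.getElem_mem _)
  · rw [List.getD_eq_default _ _ hi]
    exact .nil

/-- Soundness invariant of a certificate. The automaton may be nondeterministic: every state reached
by `w` represents the class of `w`. -/
theorem sameAction_of_mem_evalFrom (h : Certifies n gens c S V) {w : List (Fin n × Bool)}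
    {q : Fin c.1} (hq : q ∈ (c.toNFA n).evalFrom (c.toNFA n).start w) :
    FreeGroup.IsReduced (natWord w) ∧
      SameAction (wordClosure gens) {v | v ∈ V} (S.getD q []) (natWord w) := by
  induction w using List.reverseRecOn generalizing q with
  | nil =>
    have hq : (q : ℕ) ∈ c.2.1 := hq
    rw [h.start_iff q q.2] at hq
    rw [hq]
    exact ⟨.nil, .refl _ _ _⟩
  | append_singleton w a ih =>
    rw [NFA.evalFrom_append, NFA.evalFrom_singleton, NFA.mem_stepSet] at hq
    obtain ⟨p, hp, hpq⟩ := hq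
    obtain ⟨hw, hs⟩ := ih hp
    obtain ⟨hr, hs'⟩ := h.arc p p.2 q q.2 a.1 a.1.2 a.2 hpq
    rw [natWord_append]
    exact ⟨hs.isReduced_append hw hr, hs'.trans (hs.append h.isHull hw hr)⟩

theorem exists_mem_evalFrom (h : Certifies n gens c S V) {w : List (Fin n × Bool)}
    (hw : FreeGroup.IsReduced (natWord w)) :
    ∃ q, q ∈ (c.toNFA n).evalFrom (c.toNFA n).start w := by
  induction w using List.reverseRecOn with
  | nil =>
    obtain ⟨i, hi, hS⟩ := List.getElem_of_mem h.nil_mem_states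
    have hi' : i < c.1 := h.length_eq ▸ hi
    exact ⟨⟨i, hi'⟩, (h.start_iff i hi').2 (by rw [List.getD_eq_getElem _ _ hi, hS])⟩
  | append_singleton w a ih =>
    rw [natWord_append] at hw
    obtain ⟨p, hp⟩ := ih (isReduced_append_singleton.1 hw).1
    obtain ⟨-, hs⟩ := h.sameAction_of_mem_evalFrom hp
    obtain ⟨j, hj, hpj⟩ := h.exists_arc p p.2 a.1 a.1.2 a.2
      (hs.symm.isReduced_append (h.isReduced_getD p) hw)
    refine ⟨⟨j, hj⟩, ?_⟩
    rw [NFA.evalFrom_append, NFA.evalFrom_singleton, NFA.mem_stepSet]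
    exact ⟨p, hp, hpj⟩

theorem mem_accepts_iff (h : Certifies n gens c S V) {w : List (Fin n × Bool)} :
    w ∈ (c.toNFA n).accepts ↔ IsCocycleWord (wordClosure gens) (natWord w) := by
  have hacc : ∀ q : Fin c.1, q ∈ (c.toNFA n).accept ↔
      IsCocycleWord (wordClosure gens) (S.getD q []) := fun q =>
    (h.accept_iff q q.2).trans h.cocycleTest_iff
  rw [NFA.mem_accepts]
  constructor
  · rintro ⟨q, hq, hw⟩
    obtain ⟨hr, hs⟩ := h.sameAction_of_mem_evalFrom hw
    exact hs.isCocycleWord h.isHull ((hacc q).1 hq) hr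
  · intro hw
    obtain ⟨q, hq⟩ := h.exists_mem_evalFrom hw.1.isReduced
    refine ⟨q, (hacc q).2 ?_, hq⟩
    exact (h.sameAction_of_mem_evalFrom hq).2.symm.isCocycleWord h.isHull hw (h.isReduced_getD q)

end Certifies

section Computability

variable {α : Type*} [Primcodable α] {gens S V : α → List (List (ℕ × Bool))}
  {u w p q : α → List (ℕ × Bool)}

theorem computablePred_mk_mem (hg : Computable gens) (hw : Computable w) :
    ComputablePred fun a => FreeGroup.mk (w a) ∈ wordClosure (gens a) :=
  ComputablePred.preimage (f := fun a => (gens a, w a)) computablePred_mem_wordClosure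
    (hg.pair hw)

theorem computablePred_isReduced (hw : Computable w) :
    ComputablePred fun a => FreeGroup.IsReduced (w a) :=
  (ComputablePred.eq (primrec_reduce.to_comp.comp hw) hw).of_eq fun _ =>
    isReduced_iff_reduce_eq.symm

theorem computablePred_leads (hg : Computable gens) (hw : Computable w) (hp : Computable p)
    (hq : Computable q) : ComputablePred fun a => Leads (wordClosure (gens a)) (w a) (p a) (q a) :=
  computablePred_mk_mem hg (Computable.list_append.comp (Computable.list_append.comp hp hw)
    (primrec_invRev.to_comp.comp hq))

theorem computablePred_sameAction (hg : Computable gens) (hV : Computable V) (hu : Computable u)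
    (hw : Computable w) :
    ComputablePred fun a => SameAction (wordClosure (gens a)) {v | v ∈ V a} (u a) (w a) := by
  have hlast : Primrec (List.getLast? : List (ℕ × Bool) → Option (ℕ × Bool)) :=
    (Primrec.list_head?.comp Primrec.list_reverse).of_eq fun l => List.head?_reverse
  have hhead : Computable (List.head? : List (ℕ × Bool) → Option (ℕ × Bool)) :=
    Primrec.list_head?.to_comp
  have hf : Computable fun x : (α × List (ℕ × Bool)) × List (ℕ × Bool) => x.1.1 :=
    Computable.fst.comp Computable.fst
  have hp : Computable fun x : (α × List (ℕ × Bool)) × List (ℕ × Bool) => x.1.2 :=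
    Computable.snd.comp Computable.fst
  have hl : ComputablePred fun a => ∀ p ∈ V a, ∀ q ∈ V a,
      (Leads (wordClosure (gens a)) (u a) p q ↔ Leads (wordClosure (gens a)) (w a) p q) :=
    .forall_mem hV (.forall_mem (hV.comp Computable.fst)
      ((computablePred_leads (hg.comp hf) (hu.comp hf) hp Computable.snd).iff
        (computablePred_leads (hg.comp hf) (hw.comp hf) hp Computable.snd)))
  exact (((ComputablePred.eq (hhead.comp hu) (hhead.comp hw)).conj
    (ComputablePred.eq (hlast.to_comp.comp hu) (hlast.to_comp.comp hw))).conj hl).of_eq fun a =>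
    ⟨fun h => ⟨h.1.1, h.1.2, h.2⟩, fun h => ⟨⟨h.head, h.last⟩, h.leads⟩⟩

theorem computablePred_cocycleTest (hg : Computable gens) (hV : Computable V)
    (hu : Computable u) : ComputablePred fun a => CocycleTest (gens a) (V a) (u a) := by
  have hr : Primrec fun x : List (ℕ × Bool) × ℕ => (List.replicate (x.2 + 1) x.1).flatten := by
    refine (Primrec.list_flatMap (Primrec.list_range.comp (Primrec.succ.comp Primrec.snd))
      (Primrec.fst.comp Primrec.fst).to₂).of_eq fun x => ?_
    rw [List.flatMap_def]
    change ((List.range (x.2 + 1)).map fun _ => x.1).flatten = _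
    rw [List.map_const', List.length_range]
  refine (computablePred_isReduced (Computable.list_append.comp hu hu)).conj
    (.forall_lt (Computable.list_length.comp hV) (.imp (computablePred_mk_mem
      (hg.comp Computable.fst) (hr.to_comp.comp ((hu.comp Computable.fst).pair Computable.snd)))
      (.eq (hu.comp Computable.fst) (Computable.const []))))

theorem computable_getD {i : α → ℕ} (hS : Computable S) (hi : Computable i) :
    Computable fun a => (S a).getD (i a) [] :=
  (Primrec.list_getD ([] : List (ℕ × Bool))).to_comp.comp hS hi

/-- All quantifiers in a certificate range over lists, initial segments of `ℕ` or `Bool`, and the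
innermost questions reduce to membership and free reduction. -/
theorem computablePred_certifies {n : α → ℕ} {c : α → AutomatonCode} (hn : Computable n)
    (hg : Computable gens) (hc : Computable c) (hS : Computable S) (hV : Computable V) :
    ComputablePred fun a => Certifies (n a) (gens a) (c a) (S a) (V a) := by
  have hN : Computable fun a => (c a).1 := Computable.fst.comp hc
  have hstart : Computable fun a => (c a).2.1 := Computable.fst.comp (Computable.snd.comp hc)
  have haccept : Computable fun a => (c a).2.2.1 :=
    Computable.fst.comp (Computable.snd.comp (Computable.snd.comp hc))
  have harcs : Computable fun a => (c a).2.2.2 :=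
    Computable.snd.comp (Computable.snd.comp (Computable.snd.comp hc))
  have hdrop : Computable (List.dropLast : List (ℕ × Bool) → List (ℕ × Bool)) :=
    (Primrec.list_reverse.comp (Primrec.list_tail.comp Primrec.list_reverse)).to_comp.of_eq
      fun l => by rw [List.tail_reverse, List.reverse_reverse]
  have h1 : ComputablePred fun a => ([] : List (ℕ × Bool)) ∈ V a := .mem hV (Computable.const [])
  have h2 : ComputablePred fun a => ∀ v ∈ V a, v.dropLast ∈ V a :=
    .forall_mem hV (.mem (hV.comp Computable.fst) (hdrop.comp Computable.snd))
  have h3 : ComputablePred fun a => ∀ g ∈ gens a, g ∈ V a :=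
    .forall_mem hg (.mem (hV.comp Computable.fst) Computable.snd)
  have h4 : ComputablePred fun a => (c a).1 = (S a).length :=
    .eq hN (Computable.list_length.comp hS)
  have h5 : ComputablePred fun a => ([] : List (ℕ × Bool)) ∈ S a := .mem hS (Computable.const [])
  have h6 : ComputablePred fun a => ∀ s ∈ S a, FreeGroup.IsReduced s :=
    .forall_mem hS (computablePred_isReduced Computable.snd)
  have hSi : Computable fun x : α × ℕ => (S x.1).getD x.2 [] :=
    computable_getD (hS.comp Computable.fst) Computable.snd
  have h7 : ComputablePred fun a => ∀ i < (c a).1, (i ∈ (c a).2.1 ↔ (S a).getD i [] = []) :=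
    .forall_lt hN (.iff (.mem (hstart.comp Computable.fst) Computable.snd)
      (.eq hSi (Computable.const [])))
  have h8 : ComputablePred fun a => ∀ i < (c a).1,
      (i ∈ (c a).2.2.1 ↔ CocycleTest (gens a) (V a) ((S a).getD i [])) :=
    .forall_lt hN (.iff (.mem (haccept.comp Computable.fst) Computable.snd)
      (computablePred_cocycleTest (hg.comp Computable.fst) (hV.comp Computable.fst) hSi))
  have h9 : ComputablePred fun a => ∀ i < (c a).1, ∀ j < (c a).1, ∀ k < n a, ∀ b,
      (i, (k, b), j) ∈ (c a).2.2.2 → FreeGroup.IsReduced ((S a).getD i [] ++ [(k, b)]) ∧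
        SameAction (wordClosure (gens a)) {v | v ∈ V a} ((S a).getD j [])
          ((S a).getD i [] ++ [(k, b)]) := by
    refine .forall_lt hN (.forall_lt (hN.comp Computable.fst) (.forall_lt
      (hn.comp (Computable.fst.comp Computable.fst)) (.forall_bool ?_)))
    have ha : Computable fun x : (((α × ℕ) × ℕ) × ℕ) × Bool => x.1.1.1.1 :=
      Computable.fst.comp (Computable.fst.comp (Computable.fst.comp Computable.fst))
    have hi : Computable fun x : (((α × ℕ) × ℕ) × ℕ) × Bool => x.1.1.1.2 :=
      Computable.snd.comp (Computable.fst.comp (Computable.fst.comp Computable.fst))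
    have hj : Computable fun x : (((α × ℕ) × ℕ) × ℕ) × Bool => x.1.1.2 :=
      Computable.snd.comp (Computable.fst.comp Computable.fst)
    have hk : Computable fun x : (((α × ℕ) × ℕ) × ℕ) × Bool => (x.1.2, x.2) :=
      (Computable.snd.comp Computable.fst).pair Computable.snd
    have hw : Computable fun x : (((α × ℕ) × ℕ) × ℕ) × Bool =>
        (S x.1.1.1.1).getD x.1.1.1.2 [] ++ [(x.1.2, x.2)] :=
      Computable.list_append.comp (computable_getD (hS.comp ha) hi)
        (Computable.list_cons.comp hk (Computable.const []))
    exact .imp (.mem (harcs.comp ha) (hi.pair (hk.pair hj)))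
      ((computablePred_isReduced hw).conj (computablePred_sameAction (hg.comp ha) (hV.comp ha)
        (computable_getD (hS.comp ha) hj) hw))
  have h10 : ComputablePred fun a => ∀ i < (c a).1, ∀ k < n a, ∀ b,
      FreeGroup.IsReduced ((S a).getD i [] ++ [(k, b)]) →
        ∃ j < (c a).1, (i, (k, b), j) ∈ (c a).2.2.2 := by
    refine .forall_lt hN (.forall_lt (hn.comp Computable.fst) (.forall_bool ?_))
    have ha : Computable fun x : ((α × ℕ) × ℕ) × Bool => x.1.1.1 :=
      Computable.fst.comp (Computable.fst.comp Computable.fst)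
    have hi : Computable fun x : ((α × ℕ) × ℕ) × Bool => x.1.1.2 :=
      Computable.snd.comp (Computable.fst.comp Computable.fst)
    have hk : Computable fun x : ((α × ℕ) × ℕ) × Bool => (x.1.2, x.2) :=
      (Computable.snd.comp Computable.fst).pair Computable.snd
    have hw : Computable fun x : ((α × ℕ) × ℕ) × Bool =>
        (S x.1.1.1).getD x.1.1.2 [] ++ [(x.1.2, x.2)] :=
      Computable.list_append.comp (computable_getD (hS.comp ha) hi)
        (Computable.list_cons.comp hk (Computable.const []))
    exact .imp (computablePred_isReduced hw) (.exists_lt (hN.comp ha)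
      (.mem (harcs.comp (ha.comp Computable.fst)) ((hi.comp Computable.fst).pair
        ((hk.comp Computable.fst).pair Computable.snd))))
  refine ((((h1.conj h2).conj (h3.conj h4)).conj ((h5.conj h6).conj (h7.conj h8))).conj
    (h9.conj h10)).of_eq fun a => ⟨?_, ?_⟩
  · rintro ⟨⟨⟨⟨h1, h2⟩, h3, h4⟩, ⟨h5, h6⟩, h7, h8⟩, h9, h10⟩
    exact ⟨h1, h2, h3, h4, h5, h6, h7, h8, h9, h10⟩
  · rintro ⟨h1, h2, h3, h4, h5, h6, h7, h8, h9, h10⟩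
    exact ⟨⟨⟨⟨h1, h2⟩, h3, h4⟩, ⟨h5, h6⟩, h7, h8⟩, h9, h10⟩

end Computability

/-- A finite automaton that recognizes the reduced words of the cyclically reduced `∩`-cocycles of
a finitely generated subgroup is computable from generators. -/
theorem exists_computable_automaton :
    ∃ F : ℕ → List (List (ℕ × Bool)) → AutomatonCode, Computable₂ F ∧
      ∀ (n : ℕ) (gens : List (List (Fin n × Bool))),
        ((F n (encodeWords gens)).toNFA n).accepts =
          reducedWords (crMeetCocycles (subgroupOfWords gens)) := by
  let P (a : ℕ × List (List (ℕ × Bool)))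
      (z : AutomatonCode × List (List (ℕ × Bool)) × List (List (ℕ × Bool))) : Prop :=
    Certifies a.1 a.2 z.1 z.2.1 z.2.2
  have hP : ComputablePred fun x : (ℕ × List (List (ℕ × Bool))) × (AutomatonCode ×
      List (List (ℕ × Bool)) × List (List (ℕ × Bool))) => P x.1 x.2 :=
    computablePred_certifies (Computable.fst.comp Computable.fst)
      (Computable.snd.comp Computable.fst) (Computable.fst.comp Computable.snd)
      (Computable.fst.comp (Computable.snd.comp Computable.snd))
      (Computable.snd.comp (Computable.snd.comp Computable.snd))
  obtain ⟨f, hf, hPf⟩ := ComputablePred.exists_computable hP fun a => by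
    obtain ⟨c, S, V, h⟩ := exists_certifies a.1 a.2
    exact ⟨(c, S, V), h⟩
  refine ⟨fun n gens => (f (n, gens)).1, Computable.fst.comp hf, fun n gens => ?_⟩
  refine Set.ext fun w => ?_
  exact ((hPf (n, encodeWords gens)).mem_accepts_iff.trans isCocycleWord_natWord).trans
    mem_reducedWords_iff.symm

end Certificate

theorem mainTheorem11 :
    (∀ (n : ℕ) (H : Subgroup (FreeGroup (Fin n))), H.FG →
      IsRationalSubset (crMeetCocycles H) ∧
      IsRationalLanguage (reducedWords (crMeetCocycles H)) ∧
      Finite (StallingsVertex H) ∧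
      ∀ u : FreeGroup (Fin n), FreeGroup.IsCyclicallyReduced u.toWord → u ≠ 1 →
        (Subgroup.zpowers u ⊓ H = ⊥ ↔
          ¬ IsReadable (stallingsAutomaton H) (u ^ Nat.card (StallingsVertex H)).toWord)) ∧
    ∃ F : ℕ → List (List (ℕ × Bool)) → AutomatonCode, Computable₂ F ∧
      ∀ (n : ℕ) (gens : List (List (Fin n × Bool))),
        ((F n (encodeWords gens)).toNFA n).accepts =
          reducedWords (crMeetCocycles (subgroupOfWords gens)) := by
  refine ⟨fun n H hH => ?_, exists_computable_automaton⟩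
  have hrat : IsRationalLanguage (reducedWords (crMeetCocycles H)) := by
    obtain ⟨gens, rfl⟩ := exists_wordClosure_eq hH
    obtain ⟨F, -, hF⟩ := exists_computable_automaton
    have := hF n gens
    -- `subgroupOfWords` and `wordClosure` agree definitionally, as the image of a set unfolds to
    -- the same set.
    change _ = reducedWords (crMeetCocycles (wordClosure gens)) at this
    rw [← this]
    exact NFA.isRationalLanguage_accepts _
  have himage : (FreeGroup.mk : List (Fin n × Bool) → _) ''
      (reducedWords (crMeetCocycles H) : Set _) = crMeetCocycles H := by
    ext g
    constructor
    · rintro ⟨_, ⟨u, hu, rfl⟩, rfl⟩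
      rwa [FreeGroup.mk_toWord]
    · exact fun hg => ⟨_, ⟨g, hg, rfl⟩, FreeGroup.mk_toWord⟩
  have hfin := finite_stallingsVertex hH
  refine ⟨himage ▸ hrat.isRationalSubset_image, hrat, hfin, fun u hu h1 => ?_⟩
  rw [inf_comm]
  exact isMeetCocycle_iff_not_isReadable hu h1
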